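/- Let $n\ge 1$, $T>0$, $\mathbb{R}_+=[0,\infty)$ and $|x|=\sum_{i=1}^n|x_i|$ for $x\in\mathbb{R}^n$. For $i=1,\dots,n$ let $a_i,g_i,e_i:\mathbb{R}\to\mathbb{R}$ be continuous and $T$-periodic with $a_i(t)\ge 0$ and $g_i(t)>0$ for $t\in[0,T]$ ($e_i$ may take negative values), and let $f_i:\mathbb{R}_+^n\setminus\{0\}\to(0,\infty)$ be continuous with $\lim_{x\to 0}f_i(x)=\infty$. Assume that, for each $i$, the problem $u''+a_i(t)u=0$, $u(0)=u(T)$, $u'(0)=u'(T)$ has a Green function $G_i$ with $G_i(t,s)>0$ for all $(t,s)\in[0,T]\times[0,T]$. Here the Green function is the continuous function $G_i$ on $[0,T]\times[0,T]$ such that, for each $s\in(0,T)$, $G_i(\cdot,s)$ is twice differentiable on $[0,s]$ and on $[s,T]$ (one-sided derivatives at the endpoints), satisfies $\partial_t^2G_i(t,s)+a_i(t)G_i(t,s)=0$ on each of these intervals, satisfies $G_i(0,s)=G_i(T,s)$ and $\partial_tG_i(0,s)=\partial_tG_i(T,s)$, and has $\partial_tG_i(s^+,s)-\partial_tG_i(s^-,s)=1$.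 For $\lambda>0$ consider the system $$\ddot{x}_i+a_i(t)x_i=\lambda g_i(t)f_i(x)+\lambda e_i(t),\qquad i=1,\dots,n. \tag{$*$}$$ A positive periodic solution of $(*)$ is a $T$-periodic function $x=(x_1,\dots,x_n)\in C^2(\mathbb{R},\mathbb{R}^n)$ satisfying $(*)$ for all $t\in\mathbb{R}$, with $x_i(t)>0$ for all $t$ and all $i$. Limits as $x\to0$ or $|x|\to\infty$ are taken over $x\in\mathbb{R}_+^n\setminus\{0\}$. (a) If $\lim_{|x|\to\infty}f_i(x)=\infty$ and $\lim_{|x|\to\infty}f_i(x)/|x|=0$ for $i=1,\dots,n$, then there exists $\lambda_0>0$ such that $(*)$ has a positive periodic solution for every $\lambda>\lambda_0$. (b) If $\lim_{|x|\to\infty}f_i(x)/|x|=\infty$ for $i=1,\dots,n$, then there exists $\lambda_0>0$ such that $(*)$ has two distinct positive periodic solutions for every $0<\lambda<\lambda_0$. (c) There exists $\lambda_1>0$ such that $(*)$ has a positive periodic solution for every $0<\lambda<\lambda_1$. -/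

import Mathlib

open Set Filter Topology

namespace PeriodicSystem

/-- The norm `|x| = ∑ |x_i|` on `ℝⁿ`. -/
def sumNorm {n : ℕ} (x : Fin n → ℝ) : ℝ := ∑ i, |x i|

/-- The closed nonnegative orthant of `ℝⁿ` with the origin removed. -/
def puncturedOrthant (n : ℕ) : Set (Fin n → ℝ) :=
  {x | (∀ i, 0 ≤ x i) ∧ 0 < sumNorm x}

/-- The filter "`x → 0`" on the nonnegative orthant without the origin. -/
def nearZero (n : ℕ) : Filter (Fin n → ℝ) := 𝓝[puncturedOrthant n] 0

/-- The filter "`|x| → ∞`" on the nonnegative orthant. -/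
def nearInfty (n : ℕ) : Filter (Fin n → ℝ) :=
  comap sumNorm atTop ⊓ 𝓟 (puncturedOrthant n)

/-- `G` is the Green function on `[0,T] × [0,T]` of `u'' + a u` with the periodic boundary
conditions `u(0) = u(T)`, `u'(0) = u'(T)`: it is continuous on the closed square and, for every
`0 < s < T`, the function `G(·,s)` solves `u'' + a u = 0` on `[0,s]` and on `[s,T]` (one-sided
derivatives at the endpoints; `p` and `q` are the first derivatives of the two branches),
satisfies the periodic boundary conditions, and its derivative jumps by `1` at `t = s`. -/
structure IsPeriodicGreen (T : ℝ) (a : ℝ → ℝ) (G : ℝ → ℝ → ℝ) : Prop where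
  continuousOn : ContinuousOn (fun z : ℝ × ℝ => G z.1 z.2) (Icc 0 T ×ˢ Icc 0 T)
  classical : ∀ s ∈ Ioo 0 T, ∃ p q : ℝ → ℝ,
    (∀ t ∈ Icc 0 s, HasDerivWithinAt (fun τ => G τ s) (p t) (Icc 0 s) t ∧
      HasDerivWithinAt p (-(a t * G t s)) (Icc 0 s) t) ∧
    (∀ t ∈ Icc s T, HasDerivWithinAt (fun τ => G τ s) (q t) (Icc s T) t ∧
      HasDerivWithinAt q (-(a t * G t s)) (Icc s T) t) ∧
    G 0 s = G T s ∧ p 0 = q T ∧ q s - p s = 1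

/-- `x` is a positive `T`-periodic solution, of class `C²` on `ℝ`, of the system
`x_i'' + a_i(t) x_i = lam g_i(t) f_i(x) + lam e_i(t)`, every component being positive for
all `t`. -/
structure IsPositivePeriodicSolution {n : ℕ} (T : ℝ) (a g e : Fin n → ℝ → ℝ)
    (f : Fin n → (Fin n → ℝ) → ℝ) (lam : ℝ) (x : ℝ → Fin n → ℝ) : Prop where
  contDiff : ContDiff ℝ 2 x
  periodic : Function.Periodic x T
  pos : ∀ t i, 0 < x t i
  equation : ∀ t i, deriv (deriv (fun τ => x τ i)) t + a i t * x t i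
    = lam * g i t * f i (x t) + lam * e i t

end PeriodicSystem

/-!
A positive periodic solution is a fixed point of the Hammerstein operator
`u_i ↦ ∫ G_i(·, s) (λ g_i f_i(u) + λ e_i)(s) ds` on `C([0, T], ℝⁿ)`. Since the Green functions lie
between two positive constants `m` and `M`, wherever the source term is nonnegative the operator
takes values in the cone of nonnegative functions with `m u_i(t) ≤ M u_i(t')`. A function of that
cone has, at every time, a size comparable to its size `φ(u) = ∑ u_i(0)` at the initial time.
Hence a bound on the source over a shell of the orthant is enough to control the operator on the
functions whose size lies in a given interval `[r, R]`, and the source is positive on such a shell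
if the shell lies close to the origin, or far from it, where the `f_i` are large; negative values
of the `e_i` do no harm there.

Solutions come from Krasnoselskii's theorem in the cone (`exists_hammerstein_fixedPoint`).
The functional `φ` is linear, so the part of the cone with `r ≤ φ ≤ R` has the convex
parametrization `u = ρ • b`, `ρ ∈ [r, R]`, `φ(b) = 1`. Schauder's theorem applies in the
coordinates `(ρ, b)` to the map that normalizes the image in the second coordinate and moves `ρ`
towards the size of the image (compression) or away from it (expansion);
see `exists_radial_fixedPoint`. Schauder's theorem is reduced to Brouwer's theorem on a simplex,
and the latter to Scarf's lemma on finitely many ranked points (`exists_dominant_rainbow`), which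
needs no triangulation.

For small `λ`, the singularity at the origin gives a solution by compression: the source is at
least `1` near the origin, so tiny functions are enlarged, and functions of a fixed size are made
smaller (`exists_small_solution`). If the `f_i` are superlinear, expansion between a fixed larger
size and a very large one gives a second solution (`exists_large_solution`). If they are sublinear
and unbounded, compression far from the origin works for large `λ`
(`exists_solution_of_sublinear`).

That the potential `∫ G(·, s) h(s) ds` solves the equation with right-hand side `h` is proved from
Taylor's formula with integral remainder for `G(·, s)`. The slope at `0` in that formula can be
solved for from the value at `T`, which makes its dependence on `s` explicit; integrating in `s`
gives the same formula for the potential (`IsPeriodicGreen.potential_taylor`).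
-/

/-! ### Scarf's lemma -/

/-- A finite set `W` is dominant for the rankings `r i` if no point `y` is ranked strictly above
the `r i`-minimum of `W` for all `i` simultaneously. -/
def IsDominant {V N : Type*} (r : N → V → ℕ) (W : Finset V) : Prop :=
  ∀ y, ∃ i, ∀ w ∈ W, r i y ≤ r i w

section Scarf

variable {V N : Type*} {r : N → V → ℕ}

lemma IsDominant.mono {W W' : Finset V} (h : IsDominant r W) (hW : W' ⊆ W) : IsDominant r W' :=
  fun y => (h y).imp fun _ hi w hw => hi w (hW hw)

variable [Fintype V] [DecidableEq V] [Fintype N] [DecidableEq N]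

/-- The pivoting step: a dominant set with one element less than the number of rankings, lying
below every slack point `e i` except in the ranking `i`, extends to a dominant set by one element
in exactly two ways. The `r i`-minima of `W` exhaust `W`, so exactly two rankings `i`, `j` share
their minimum; the two extensions replace the minimum of one of these two rankings. -/
lemma exists_two_dominant_insert (hr : ∀ i, Function.Injective (r i)) {e : N → V} {W : Finset V}
    (hW : IsDominant r W) (hcard : W.card + 1 = Fintype.card N) {x : V} (hxW : x ∈ W)
    (hx : ∀ i j, j ≠ i → r i x < r i (e j)) :
    ∃ v v', v ≠ v' ∧ ∀ u, (u ∉ W ∧ IsDominant r (insert u W)) ↔ u = v ∨ u = v' := by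
  have hmin : ∀ i, ∃ w ∈ W, ∀ w' ∈ W, r i w ≤ r i w' := fun i =>
    Finset.exists_min_image W (r i) ⟨x, hxW⟩
  choose μ hμW hμ using hmin
  -- by counting, `μ` is injective on the complement of a ranking if it maps it onto `W`
  have hinj : ∀ k, (∀ w ∈ W, ∃ l, l ≠ k ∧ μ l = w) →
      ∀ l l', l ≠ k → l' ≠ k → μ l = μ l' → l = l' := by
    intro k hk l l' hl hl' hll
    have hsurj : Set.SurjOn μ (Finset.univ.erase k : Finset N) (W : Set V) := by
      intro w hw
      obtain ⟨l, hl, rfl⟩ := hk w (by simpa using hw)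
      exact ⟨l, by simpa using hl, rfl⟩
    have := Finset.injOn_of_surjOn_of_card_le μ (s := Finset.univ.erase k) (t := W)
      (fun i _ => hμW i) hsurj (by
        rw [Finset.card_erase_of_mem (Finset.mem_univ _), Finset.card_univ]; omega)
    exact this (by simpa using hl) (by simpa using hl') hll
  have hsurj : ∀ w ∈ W, ∃ i, μ i = w := by
    intro w hw
    obtain ⟨i, hi⟩ := hW w
    exact ⟨i, hr i (le_antisymm (hμ i w hw) (hi _ (hμW i)))⟩
  obtain ⟨i, j, hij, hμij⟩ : ∃ i j, i ≠ j ∧ μ i = μ j := by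
    obtain ⟨i, -, j, -, hij, h⟩ := Finset.exists_ne_map_eq_of_card_lt_of_maps_to
      (s := (Finset.univ : Finset N)) (t := W) (f := μ)
      (by rw [Finset.card_univ]; omega) (fun i _ => hμW i)
    exact ⟨i, j, hij, h⟩
  have hsurj' : ∀ k, (k = i ∨ k = j) → ∀ w ∈ W, ∃ l, l ≠ k ∧ μ l = w := by
    intro k hk w hw
    obtain ⟨l, hl⟩ := hsurj w hw
    by_cases hlk : l = k
    · subst hlk
      rcases hk with rfl | rfl
      · exact ⟨j, hij.symm, hμij ▸ hl⟩
      · exact ⟨i, hij, hμij.trans hl⟩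
    · exact ⟨l, hlk, hl⟩
  have hdom : ∀ y k, (∀ l, l ≠ k → r l (μ l) < r l y) → ∀ w ∈ W, r k y ≤ r k w := by
    intro y k hy
    obtain ⟨l, hl⟩ := hW y
    by_cases hlk : l = k
    · exact hlk ▸ hl
    · exact absurd (hl _ (hμW l)) (not_le.mpr (hy l hlk))
  have hmax : ∀ k, ∃ v, (∀ l, l ≠ k → r l (μ l) < r l v) ∧
      ∀ y, (∀ l, l ≠ k → r l (μ l) < r l y) → r k y ≤ r k v := by
    intro k
    obtain ⟨v, hv, hv'⟩ := Finset.exists_max_image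
      (Finset.univ.filter fun y => ∀ l, l ≠ k → r l (μ l) < r l y) (r k)
      ⟨e k, by
        simp only [Finset.mem_filter, Finset.mem_univ, true_and]
        exact fun l hl => (hμ l x hxW).trans_lt (hx l k hl.symm)⟩
    simp only [Finset.mem_filter, Finset.mem_univ, true_and] at hv hv'
    exact ⟨v, hv, hv'⟩
  choose v hv hvmax using hmax
  have hvdom : ∀ k, (k = i ∨ k = j) → v k ∉ W ∧ IsDominant r (insert (v k) W) := by
    intro k hk
    refine ⟨fun hvW => ?_, fun y => ?_⟩
    · obtain ⟨l, hl, hlv⟩ := hsurj' k hk _ hvW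
      exact (hv k l hl).ne (by rw [hlv])
    · by_cases hy : ∀ l, l ≠ k → r l (μ l) < r l y
      · refine ⟨k, fun w hw => ?_⟩
        rcases Finset.mem_insert.mp hw with rfl | hw
        · exact hvmax k y hy
        · exact hdom y k hy w hw
      · push Not at hy
        obtain ⟨l, hl, hly⟩ := hy
        refine ⟨l, fun w hw => ?_⟩
        rcases Finset.mem_insert.mp hw with rfl | hw
        · exact hly.trans (hv k l hl).le
        · exact hly.trans (hμ l w hw)
  refine ⟨v i, v j, fun h => ?_, fun u => ⟨?_, ?_⟩⟩
  · obtain ⟨k, hk⟩ := hW (v i)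
    by_cases hki : k = i
    · have h1 := hv j k (hki ▸ hij)
      rw [← h] at h1
      exact absurd (hk _ (hμW k)) (not_le.mpr h1)
    · exact absurd (hk _ (hμW k)) (not_le.mpr (hv i k hki))
  · rintro ⟨huW, hu⟩
    obtain ⟨k, hk⟩ := hu u
    have hkW : ∀ w ∈ W, r k u < r k w := fun w hw =>
      lt_of_le_of_ne (hk w (Finset.mem_insert_of_mem hw)) fun h => huW (hr k h ▸ hw)
    have hw : ∀ w ∈ W, ∃ l, l ≠ k ∧ μ l = w ∧ r l (μ l) < r l u := by
      intro w hw
      obtain ⟨l, hl⟩ := hu w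
      have hlw : μ l = w := hr l
        (le_antisymm (hμ l w hw) (hl _ (Finset.mem_insert_of_mem (hμW l))))
      refine ⟨l, ?_, hlw, ?_⟩
      · rintro rfl
        exact absurd (hl u (Finset.mem_insert_self _ _)) (not_le.mpr (hkW w hw))
      · rw [hlw]
        exact lt_of_le_of_ne (hl u (Finset.mem_insert_self _ _)) fun h => huW (hr l h ▸ hw)
    have hk' : ∀ l l', l ≠ k → l' ≠ k → μ l = μ l' → l = l' :=
      hinj k fun w h => let ⟨l, h1, h2, _⟩ := hw w h; ⟨l, h1, h2⟩
    have hkij : k = i ∨ k = j := by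
      by_contra! h
      exact hij (hk' i j h.1.symm h.2.symm hμij)
    have huM : ∀ l, l ≠ k → r l (μ l) < r l u := by
      intro l hl
      obtain ⟨l', h1, h2, h3⟩ := hw (μ l) (hμW l)
      rwa [hk' l l' hl h1 h2.symm]
    have huv : u = v k := by
      obtain ⟨l, hl⟩ := hu (v k)
      have hlk : l = k := by
        by_contra hlk
        exact absurd (hl _ (Finset.mem_insert_of_mem (hμW l))) (not_le.mpr (hv k l hlk))
      subst hlk
      exact hr l (le_antisymm (hvmax l u huM) (hl u (Finset.mem_insert_self _ _)))
    rcases hkij with rfl | rfl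
    · exact Or.inl huv
    · exact Or.inr huv
  · rintro (rfl | rfl)
    · exact hvdom i (Or.inl rfl)
    · exact hvdom j (Or.inr rfl)

/-- A set that is not rainbow has an even number of facets carrying exactly the colours other
than `i₀`. -/
lemma even_card_facets (c : V → N) (i₀ : N) {W : Finset V} (hcard : W.card = Fintype.card N)
    (hc : W.image c ≠ Finset.univ) :
    Even (Finset.univ.filter fun d : Finset V =>
      d ⊆ W ∧ d.card + 1 = Fintype.card N ∧ d.image c = Finset.univ.erase i₀).card := by
  set D := Finset.univ.filter fun d : Finset V =>
      d ⊆ W ∧ d.card + 1 = Fintype.card N ∧ d.image c = Finset.univ.erase i₀ with hD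
  have herase : ∀ d, d ∈ D ↔ (∃ w ∈ W, d = W.erase w) ∧ d.image c = Finset.univ.erase i₀ := by
    intro d
    simp only [hD, Finset.mem_filter, Finset.mem_univ, true_and]
    constructor
    · rintro ⟨h1, h2, h3⟩
      obtain ⟨w, hw, rfl⟩ := Finset.exists_eq_insert_iff.mpr ⟨h1, h2.trans hcard.symm⟩
      exact ⟨⟨w, Finset.mem_insert_self _ _, (Finset.erase_insert hw).symm⟩, h3⟩
    · rintro ⟨⟨w, hw, rfl⟩, h3⟩
      exact ⟨Finset.erase_subset _ _, (Finset.card_erase_add_one hw).trans hcard, h3⟩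
  rcases D.eq_empty_or_nonempty with h0 | ⟨d, hd⟩
  · simp [h0]
  obtain ⟨⟨w, hw, rfl⟩, hdc⟩ := (herase d).mp hd
  have hins : W.image c = insert (c w) (Finset.univ.erase i₀) := by
    rw [← hdc, ← Finset.image_insert, Finset.insert_erase hw]
  have hcw : c w ∈ (W.erase w).image c := by
    rw [hdc, Finset.mem_erase]
    refine ⟨fun h => hc ?_, Finset.mem_univ _⟩
    rw [hins, h, Finset.insert_erase (Finset.mem_univ _)]
  obtain ⟨w', hw', hcw'⟩ := Finset.mem_image.mp hcw
  have hne : w' ≠ w := Finset.ne_of_mem_erase hw'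
  have hw'W : w' ∈ W := Finset.mem_of_mem_erase hw'
  have himg : (W.erase w').image c = Finset.univ.erase i₀ := by
    rw [← hdc]
    ext k
    simp only [Finset.mem_image, Finset.mem_erase]
    constructor
    · rintro ⟨u, ⟨hu, huW⟩, rfl⟩
      by_cases huw : u = w
      · exact ⟨w', ⟨hne, hw'W⟩, by rw [huw, hcw']⟩
      · exact ⟨u, ⟨huw, huW⟩, rfl⟩
    · rintro ⟨u, ⟨hu, huW⟩, rfl⟩
      by_cases huw : u = w'
      · exact ⟨w, ⟨hne.symm, hw⟩, by rw [huw, hcw']⟩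
      · exact ⟨u, ⟨huw, huW⟩, rfl⟩
  have hD2 : D = {W.erase w, W.erase w'} := by
    ext d
    rw [herase, Finset.mem_insert, Finset.mem_singleton]
    constructor
    · rintro ⟨⟨u, hu, rfl⟩, h⟩
      by_contra! hu'
      have h1 : w ∈ W.erase u := Finset.mem_erase.mpr ⟨fun h => hu'.1 (h ▸ rfl), hw⟩
      have h2 : w' ∈ W.erase u := Finset.mem_erase.mpr ⟨fun h => hu'.2 (h ▸ rfl), hw'W⟩
      have hcard' : ((W.erase u).image c).card = (W.erase u).card := by
        rw [h, Finset.card_erase_of_mem (Finset.mem_univ _), Finset.card_univ,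
          Finset.card_erase_of_mem hu, hcard]
      exact hne (Finset.card_image_iff.mp hcard' h2 h1 hcw')
    · rintro (rfl | rfl)
      · exact ⟨⟨w, hw, rfl⟩, hdc⟩
      · exact ⟨⟨w', hw'W, rfl⟩, himg⟩
  rw [hD2, Finset.card_pair]
  · exact even_two
  · intro h
    exact Finset.notMem_erase w' W (h ▸ hw')

/-- **Scarf's lemma.** Finitely many points are ranked in several ways, and coloured by the
rankings. If there is a slack point `e i` of colour `i` for each `i`, ranked lowest by `r i` and
above all ordinary points by the other rankings, then some dominant set carries every colour.
The proof counts incidences between dominant sets of full size and their dominant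
facets that miss exactly the colour `i₀`, modulo two. -/
theorem exists_dominant_rainbow [Nonempty N] (hr : ∀ i, Function.Injective (r i)) (e : N → V)
    (he : Function.Injective e) (hbot : ∀ i v, r i (e i) ≤ r i v)
    (htop : ∀ x, x ∉ Set.range e → ∀ i j, j ≠ i → r i x < r i (e j))
    (hne : ∃ x, x ∉ Set.range e) (c : V → N) (hc : ∀ i, c (e i) = i) :
    ∃ W : Finset V, IsDominant r W ∧ W.image c = Finset.univ := by
  classical
  by_contra! hcon
  obtain ⟨i₀⟩ := ‹Nonempty N›
  set R := Finset.univ.filter fun W : Finset V => IsDominant r W ∧ W.card = Fintype.card N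
    with hR
  set D := Finset.univ.filter fun d : Finset V => IsDominant r d ∧ d.card + 1 = Fintype.card N ∧
    d.image c = Finset.univ.erase i₀ with hD
  have hcount := Finset.sum_card_bipartiteAbove_eq_sum_card_bipartiteBelow
    (s := D) (t := R) (fun d W : Finset V => d ⊆ W)
  -- every dominant set of full size has an even number of facets in `D`
  have heven : Even (∑ W ∈ R, (D.bipartiteBelow (fun d W : Finset V => d ⊆ W) W).card) := by
    refine Finset.even_sum _ fun W hW => ?_
    simp only [hR, Finset.mem_filter, Finset.mem_univ, true_and] at hW
    have hbelow : D.bipartiteBelow (fun d W : Finset V => d ⊆ W) W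
        = Finset.univ.filter fun d : Finset V => d ⊆ W ∧ d.card + 1 = Fintype.card N ∧
          d.image c = Finset.univ.erase i₀ := by
      ext d
      simp only [Finset.mem_bipartiteBelow, hD, Finset.mem_filter, Finset.mem_univ, true_and]
      exact ⟨fun h => ⟨h.2, h.1.2⟩, fun h => ⟨⟨hW.1.mono h.1, h.2⟩, h.1⟩⟩
    rw [hbelow]
    exact even_card_facets c i₀ hW.2 (hcon W hW.1)
  have habove : ∀ d ∈ D, (R.bipartiteAbove (fun d W : Finset V => d ⊆ W) d)
      = (Finset.univ.filter fun u => u ∉ d ∧ IsDominant r (insert u d)).image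
        (fun u => insert u d) := by
    intro d hd
    simp only [hD, Finset.mem_filter, Finset.mem_univ, true_and] at hd
    ext W
    simp only [Finset.mem_bipartiteAbove, hR, Finset.mem_filter, Finset.mem_univ, true_and,
      Finset.mem_image]
    constructor
    · rintro ⟨⟨h1, h2⟩, h3⟩
      obtain ⟨u, hu, rfl⟩ := Finset.exists_eq_insert_iff.mpr ⟨h3, hd.2.1.trans h2.symm⟩
      exact ⟨u, ⟨hu, h1⟩, rfl⟩
    · rintro ⟨u, ⟨hu, h1⟩, rfl⟩
      exact ⟨⟨h1, (Finset.card_insert_of_notMem hu).trans hd.2.1⟩, Finset.subset_insert _ _⟩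
  have hcardabove : ∀ d ∈ D, (R.bipartiteAbove (fun d W : Finset V => d ⊆ W) d).card
      = (Finset.univ.filter fun u => u ∉ d ∧ IsDominant r (insert u d)).card := by
    intro d hd
    rw [habove d hd]
    refine Finset.card_image_of_injOn fun u hu u' hu' h => ?_
    simp only [Finset.coe_filter, Finset.mem_univ, true_and, Set.mem_ofPred_eq] at hu hu'
    have : u ∈ insert u' d := h ▸ Finset.mem_insert_self u d
    exact (Finset.mem_insert.mp this).resolve_right hu.1
  -- the slack facet opposite to `e i₀` is the only facet in a single dominant set
  set d₀ := (Finset.univ.erase i₀).image e with hd₀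
  have hmem₀ : ∀ i, i ≠ i₀ → e i ∈ d₀ := fun i hi =>
    Finset.mem_image_of_mem _ (Finset.mem_erase.mpr ⟨hi, Finset.mem_univ _⟩)
  have hmem₀' : ∀ w ∈ d₀, ∃ i, i ≠ i₀ ∧ e i = w := by
    intro w hw
    obtain ⟨i, hi, rfl⟩ := Finset.mem_image.mp hw
    exact ⟨i, Finset.ne_of_mem_erase hi, rfl⟩
  have hd₀D : d₀ ∈ D := by
    simp only [hD, Finset.mem_filter, Finset.mem_univ, true_and]
    refine ⟨fun y => ?_, ?_, ?_⟩
    · by_cases hy : y ∈ Set.range e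
      · obtain ⟨i, rfl⟩ := hy
        exact ⟨i, fun w _ => hbot i w⟩
      · refine ⟨i₀, fun w hw => ?_⟩
        obtain ⟨i, hi, rfl⟩ := hmem₀' w hw
        exact (htop y hy i₀ i hi).le
    · rw [hd₀, Finset.card_image_of_injective _ he, Finset.card_erase_add_one (Finset.mem_univ _),
        Finset.card_univ]
    · rw [hd₀, Finset.image_image]
      conv_rhs => rw [← Finset.image_id (s := Finset.univ.erase i₀)]
      exact Finset.image_congr fun i _ => hc i
  have hone : (R.bipartiteAbove (fun d W : Finset V => d ⊆ W) d₀).card = 1 := by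
    rw [hcardabove d₀ hd₀D, Finset.card_eq_one]
    obtain ⟨z, hz⟩ := hne
    obtain ⟨v, hv, hvmax⟩ := Finset.exists_max_image
      (Finset.univ.filter fun x => x ∉ Set.range e) (r i₀) ⟨z, by simpa using hz⟩
    simp only [Finset.mem_filter, Finset.mem_univ, true_and] at hv hvmax
    have key : ∀ u y, y ∉ Set.range e → ∀ i, (∀ w ∈ insert u d₀, r i y ≤ r i w) → i = i₀ := by
      intro u y hy i hi
      by_contra h
      have h1 := hi (e i) (Finset.mem_insert_of_mem (hmem₀ i h))
      exact hy ⟨i, hr i (le_antisymm (hbot i y) h1)⟩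
    refine ⟨v, ?_⟩
    ext u
    simp only [Finset.mem_filter, Finset.mem_univ, true_and, Finset.mem_singleton]
    constructor
    · rintro ⟨hu, hud⟩
      obtain ⟨i, hi⟩ := hud v
      obtain rfl := key u v hv i hi
      have hvu : r i v ≤ r i u := hi u (Finset.mem_insert_self _ _)
      have hue : u ∉ Set.range e := by
        rintro ⟨j, rfl⟩
        by_cases hj : j = i
        · subst hj
          exact hv ⟨j, hr j (le_antisymm (hbot j v) hvu)⟩
        · exact hu (hmem₀ j hj)
      exact hr i (le_antisymm (hvmax u hue) hvu)
    · rintro rfl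
      refine ⟨fun h => ?_, fun y => ?_⟩
      · obtain ⟨i, _, hi⟩ := hmem₀' _ h
        exact hv ⟨i, hi⟩
      · by_cases hy : y ∈ Set.range e
        · obtain ⟨i, rfl⟩ := hy
          exact ⟨i, fun w _ => hbot i w⟩
        · refine ⟨i₀, fun w hw => ?_⟩
          rcases Finset.mem_insert.mp hw with rfl | hw
          · exact hvmax y hy
          · obtain ⟨i, hi, rfl⟩ := hmem₀' w hw
            exact (htop y hy i₀ i hi).le
  have htwo : ∀ d ∈ D.erase d₀,
      Even (R.bipartiteAbove (fun d W : Finset V => d ⊆ W) d).card := by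
    intro d hd
    obtain ⟨hdd, hdD⟩ := Finset.mem_erase.mp hd
    rw [hcardabove d hdD]
    simp only [hD, Finset.mem_filter, Finset.mem_univ, true_and] at hdD
    obtain ⟨x, hxd, hx⟩ : ∃ x ∈ d, x ∉ Set.range e := by
      by_contra! hall
      refine hdd (Finset.eq_of_subset_of_card_le ?_ ?_)
      · intro w hw
        obtain ⟨i, rfl⟩ := hall w hw
        refine hmem₀ i ?_
        have := Finset.mem_image_of_mem c hw
        rw [hdD.2.2, hc] at this
        exact Finset.ne_of_mem_erase this
      · rw [hd₀, Finset.card_image_of_injective _ he, Finset.card_erase_of_mem (Finset.mem_univ _),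
          Finset.card_univ]
        omega
    obtain ⟨v, v', hvv, hu⟩ := exists_two_dominant_insert hr hdD.1 hdD.2.1 hxd (htop x hx)
    have : (Finset.univ.filter fun u => u ∉ d ∧ IsDominant r (insert u d)) = {v, v'} := by
      ext u
      simp only [Finset.mem_filter, Finset.mem_univ, true_and, Finset.mem_insert,
        Finset.mem_singleton]
      exact hu u
    rw [this, Finset.card_pair hvv]
    exact even_two
  rw [← hcount, ← Finset.add_sum_erase D _ hd₀D, hone] at heven
  have h2 := Finset.even_sum _ htwo
  rw [Nat.even_add] at heven
  exact absurd (heven.mpr h2) (by decide)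

end Scarf

/-! ### Brouwer's fixed point theorem -/

section Brouwer

variable {ι : Type*} [Fintype ι]

/-- The lattice points of the standard simplex dilated by `m`. -/
abbrev LatticeSimplex (ι : Type*) [Fintype ι] (m : ℕ) : Type _ :=
  {x : ι → Fin (m + 1) // ∑ i, (x i : ℕ) = m}

/-- Scarf's lemma for the lattice points of a dilated simplex, ranked by their coordinates, with
ties broken by a fixed enumeration. Each colour is carried by a point close to `x₀`, except for
those colours whose coordinate of `x₀` is small. -/
lemma exists_lattice_rainbow [Nonempty ι] (m : ℕ)
    (c : LatticeSimplex ι m → ι) : ∃ x₀ : LatticeSimplex ι m, ∀ i,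
      (x₀.1 i : ℕ) < Fintype.card ι ∨
      ∃ s : LatticeSimplex ι m, c s = i ∧
        ∀ j, (x₀.1 j : ℕ) < s.1 j + Fintype.card ι ∧ (s.1 j : ℕ) < x₀.1 j + Fintype.card ι := by
  classical
  let T := LatticeSimplex ι m
  set K := Fintype.card T
  set n := Fintype.card ι
  let r : ι → T ⊕ ι → ℕ := fun i => Sum.elim
    (fun x => (x.1 i : ℕ) * K + Fintype.equivFin T x + 1)
    (fun j => if j = i then 0 else (m + 1) * K + 1 + Fintype.equivFin ι j)
  have hidx : ∀ x : T, (Fintype.equivFin T x : ℕ) < K := fun x => (Fintype.equivFin T x).2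
  have hbound : ∀ (x : T) i, (x.1 i : ℕ) * K + Fintype.equivFin T x < (m + 1) * K := by
    intro x i
    have h1 : (x.1 i : ℕ) + 1 ≤ m + 1 := (x.1 i).2
    have h2 := Nat.mul_le_mul_right K h1
    have := hidx x
    rw [add_mul, one_mul] at h2
    omega
  have hlt : ∀ (x y : T) i, (x.1 i : ℕ) < y.1 i → r i (Sum.inl x) < r i (Sum.inl y) := by
    intro x y i h
    have h2 := Nat.mul_le_mul_right K (Nat.succ_le_of_lt h)
    have := hidx x
    rw [Nat.succ_eq_add_one, add_mul, one_mul] at h2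
    simp only [r, Sum.elim_inl]
    omega
  have hr : ∀ i, Function.Injective (r i) := by
    rintro i (x | j) (y | k) h
    · rcases lt_trichotomy (x.1 i : ℕ) (y.1 i : ℕ) with h1 | h1 | h1
      · exact absurd h (hlt x y i h1).ne
      · simp only [r, Sum.elim_inl, h1] at h
        exact congrArg _ ((Fintype.equivFin T).injective (Fin.ext (by omega)))
      · exact absurd h (hlt y x i h1).ne'
    · have := hbound x i
      simp only [r, Sum.elim_inl, Sum.elim_inr] at h
      split_ifs at h
      omega
    · have := hbound y i
      simp only [r, Sum.elim_inl, Sum.elim_inr] at h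
      split_ifs at h
      omega
    · simp only [r, Sum.elim_inr] at h
      split_ifs at h with h1 h2 h2
      · rw [h1, h2]
      · omega
      · omega
      · exact congrArg _ ((Fintype.equivFin ι).injective (Fin.ext (by omega)))
  have hpt : ∀ (i₁ : ι) (b : ι → ℕ), ∑ i, b i ≤ m → ∃ y : T, ∀ i, b i ≤ y.1 i := by
    intro i₁ b hb
    have hsum : ∑ i, (b i + if i = i₁ then m - ∑ i, b i else 0) = m := by
      rw [Finset.sum_add_distrib, Finset.sum_ite_eq' Finset.univ i₁, if_pos (Finset.mem_univ _)]
      omega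
    have hle : ∀ i, (b i + if i = i₁ then m - ∑ i, b i else 0) < m + 1 := by
      intro i
      have := Finset.single_le_sum (f := fun i => b i + if i = i₁ then m - ∑ i, b i else 0)
        (fun _ _ => Nat.zero_le _) (Finset.mem_univ i)
      omega
    exact ⟨⟨fun i => ⟨_, hle i⟩, hsum⟩, fun i => Nat.le_add_right _ _⟩
  obtain ⟨i₁⟩ := id ‹Nonempty ι›
  obtain ⟨z, -⟩ := hpt i₁ (fun _ => 0) (by simp)
  obtain ⟨W, hW, hWc⟩ := exists_dominant_rainbow (r := r) hr Sum.inr Sum.inr_injective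
    (fun i v => by simp [r])
    (by
      rintro (x | j) hx i j' hj'
      · have := hbound x i
        simp only [r, Sum.elim_inl, Sum.elim_inr, if_neg hj']
        omega
      · exact absurd ⟨j, rfl⟩ hx)
    ⟨Sum.inl z, by simp⟩ (Sum.elim c id) (fun i => rfl)
  -- `C` is the set of rankings whose slack point is not used
  set C := Finset.univ.filter fun i => Sum.inr i ∉ W with hC
  have hdom : ∀ y : T, ∃ i ∈ C, ∀ s : T, Sum.inl s ∈ W → (y.1 i : ℕ) ≤ s.1 i := by
    intro y
    obtain ⟨i, hi⟩ := hW (Sum.inl y)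
    refine ⟨i, ?_, fun s hs => ?_⟩
    · simp only [hC, Finset.mem_filter, Finset.mem_univ, true_and]
      intro h
      have := hi _ h
      simp [r] at this
    · by_contra! h
      exact absurd (hi _ hs) (not_le.mpr (hlt s y i h))
  have hcol : ∀ i ∈ C, ∃ s : T, Sum.inl s ∈ W ∧ c s = i := by
    intro i hi
    have : i ∈ W.image (Sum.elim c id) := hWc ▸ Finset.mem_univ i
    obtain ⟨s | j, hs, hsi⟩ := Finset.mem_image.mp this
    · exact ⟨s, hs, hsi⟩
    · simp only [Sum.elim_inr, id] at hsi
      subst hsi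
      exact absurd hs (by simpa [hC] using hi)
  obtain ⟨i₂, hi₂, -⟩ := hdom z
  obtain ⟨x₀, hx₀, -⟩ := hcol i₂ hi₂
  have hmin : ∀ i, ∃ s : T, Sum.inl s ∈ W ∧ ∀ s' : T, Sum.inl s' ∈ W → (s.1 i : ℕ) ≤ s'.1 i := by
    intro i
    obtain ⟨s, hs, hs'⟩ := Finset.exists_min_image
      (Finset.univ.filter fun s : T => Sum.inl s ∈ W) (fun s => (s.1 i : ℕ)) ⟨x₀, by simpa using hx₀⟩
    simp only [Finset.mem_filter, Finset.mem_univ, true_and] at hs hs'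
    exact ⟨s, hs, hs'⟩
  choose μ hμW hμ using hmin
  -- dominance forces the coordinatewise minima over `C` to nearly exhaust the total
  have hgt : m < ∑ i, if i ∈ C then ((μ i).1 i : ℕ) + 1 else 0 := by
    by_contra! h
    obtain ⟨y, hy⟩ := hpt i₁ _ h
    obtain ⟨i, hi, hyi⟩ := hdom y
    have h1 := hy i
    rw [if_pos hi] at h1
    have := hyi _ (hμW i)
    omega
  have hnear : ∀ s : T, Sum.inl s ∈ W → ∀ i,
      (s.1 i : ℕ) < (if i ∈ C then ((μ i).1 i : ℕ) else 0) + n := by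
    intro s hs i
    have h1 : ∑ j, (if j ∈ C then ((μ j).1 j : ℕ) + 1 else 0)
        ≤ ∑ j, (if j ∈ C then ((μ j).1 j : ℕ) else 0) + n := by
      have : n = ∑ _j : ι, 1 := by simp [n]
      rw [this, ← Finset.sum_add_distrib]
      refine Finset.sum_le_sum fun j _ => ?_
      split_ifs <;> omega
    have h2 : ∑ j ∈ Finset.univ.erase i, (if j ∈ C then ((μ j).1 j : ℕ) else 0)
        ≤ ∑ j ∈ Finset.univ.erase i, (s.1 j : ℕ) := by
      refine Finset.sum_le_sum fun j _ => ?_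
      split_ifs
      · exact hμ j s hs
      · omega
    have h3 := s.2
    rw [← Finset.add_sum_erase _ _ (Finset.mem_univ i)] at h3
    rw [← Finset.add_sum_erase Finset.univ (fun j => if j ∈ C then ((μ j).1 j : ℕ) else 0)
      (Finset.mem_univ i)] at h1
    omega
  have hclose : ∀ s t : T, Sum.inl s ∈ W → Sum.inl t ∈ W → ∀ j, (s.1 j : ℕ) < t.1 j + n := by
    intro s t hs ht j
    refine (hnear s hs j).trans_le (Nat.add_le_add_right ?_ n)
    split_ifs
    · exact hμ j t ht
    · omega
  refine ⟨x₀, fun i => ?_⟩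
  by_cases hi : i ∈ C
  · obtain ⟨s, hs, hsi⟩ := hcol i hi
    exact Or.inr ⟨s, hsi, fun j => ⟨hclose _ _ hx₀ hs j, hclose _ _ hs hx₀ j⟩⟩
  · have := hnear x₀ hx₀ i
    rw [if_neg hi] at this
    exact Or.inl (by omega)

/-- **Brouwer's fixed point theorem** for the standard simplex. -/
theorem exists_fixedPoint_stdSimplex [Nonempty ι] (f : (ι → ℝ) → ι → ℝ)
    (hf : ContinuousOn f (stdSimplex ℝ ι)) (hmaps : MapsTo f (stdSimplex ℝ ι) (stdSimplex ℝ ι)) :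
    ∃ x ∈ stdSimplex ℝ ι, f x = x := by
  classical
  -- approximate solutions of `x ≤ f x`
  have happrox : ∀ ε > 0, ∃ x ∈ stdSimplex ℝ ι, ∀ i, x i - f x i ≤ ε := by
    intro ε hε
    have huc := (isCompact_stdSimplex ℝ ι).uniformContinuousOn_of_continuous hf
    rw [Metric.uniformContinuousOn_iff_le] at huc
    obtain ⟨δ, hδ, huc⟩ := huc (ε / 2) (half_pos hε)
    obtain ⟨m, hm⟩ := exists_nat_gt ((Fintype.card ι : ℝ) / min δ (ε / 2))
    have hmin : 0 < min δ (ε / 2) := lt_min hδ (half_pos hε)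
    have hm0 : (0 : ℝ) < m := lt_of_le_of_lt (by positivity) hm
    have hnm : (Fintype.card ι : ℝ) / m ≤ min δ (ε / 2) := by
      rw [div_le_iff₀ hm0]
      rw [div_lt_iff₀ hmin] at hm
      linarith
    let p : LatticeSimplex ι m → ι → ℝ := fun x i => (x.1 i : ℕ) / m
    have hp : ∀ x, p x ∈ stdSimplex ℝ ι := by
      intro x
      refine ⟨fun i => by positivity, ?_⟩
      simp only [p]
      rw [← Finset.sum_div, div_eq_one_iff_eq hm0.ne']
      exact_mod_cast x.2
    have hcol : ∀ x, ∃ i, p x i ≤ f (p x) i := by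
      intro x
      by_contra! h
      have h1 := Finset.sum_lt_sum_of_nonempty (Finset.univ_nonempty (α := ι)) fun i _ => h i
      rw [(hmaps (hp x)).2, (hp x).2] at h1
      exact lt_irrefl _ h1
    choose c hc using hcol
    obtain ⟨x₀, hx₀⟩ := exists_lattice_rainbow m c
    refine ⟨p x₀, hp x₀, fun i => ?_⟩
    have hε2 := hnm.trans (min_le_right _ _)
    rcases hx₀ i with hi | ⟨s, hs, hclose⟩
    · have h0 : 0 ≤ f (p x₀) i := (hmaps (hp x₀)).1 i
      have h1 : p x₀ i ≤ (Fintype.card ι : ℝ) / m := by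
        simp only [p]
        gcongr
      linarith
    · have hd : ∀ j, |p x₀ j - p s j| ≤ (Fintype.card ι : ℝ) / m := by
        intro j
        have h1 : ((x₀.1 j : ℕ) : ℝ) ≤ (s.1 j : ℕ) + Fintype.card ι := by
          exact_mod_cast (hclose j).1.le
        have h2 : ((s.1 j : ℕ) : ℝ) ≤ (x₀.1 j : ℕ) + Fintype.card ι := by
          exact_mod_cast (hclose j).2.le
        simp only [p]
        rw [← sub_div, abs_div, abs_of_pos hm0]
        gcongr
        rw [abs_le]
        constructor <;> linarith
      have hdist : dist (p x₀) (p s) ≤ δ :=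
        (dist_pi_le_iff hδ.le).mpr fun j =>
          (hd j).trans (hnm.trans (min_le_left _ _))
      have h1 := (dist_le_pi_dist _ _ i).trans (huc _ (hp x₀) _ (hp s) hdist)
      have h2 := hc s
      rw [hs] at h2
      have h3 := hd i
      rw [Real.dist_eq, abs_le] at h1
      rw [abs_le] at h3
      linarith [h1.1, h3.2]
  have hcont : ContinuousOn (fun x => ∑ i, max 0 (x i - f x i)) (stdSimplex ℝ ι) := by
    refine continuousOn_finsetSum _ fun i _ => ContinuousOn.sup continuousOn_const ?_
    exact (continuous_apply i).continuousOn.sub ((continuous_apply i).comp_continuousOn hf)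
  obtain ⟨i₁⟩ := id ‹Nonempty ι›
  obtain ⟨x, hx, hxmin⟩ := (isCompact_stdSimplex ℝ ι).exists_isMinOn
    ⟨_, single_mem_stdSimplex ℝ i₁⟩ hcont
  have hzero : ∑ i, max 0 (x i - f x i) ≤ 0 := by
    refine le_of_forall_pos_le_add fun ε hε => ?_
    obtain ⟨y, hy, hyε⟩ := happrox (ε / Fintype.card ι) (div_pos hε (by
      exact_mod_cast Fintype.card_pos))
    refine (hxmin hy).trans ?_
    calc ∑ i, max 0 (y i - f y i) ≤ ∑ _i : ι, ε / Fintype.card ι :=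
          Finset.sum_le_sum fun i _ => max_le (by positivity) (hyε i)
      _ = 0 + ε := by
          rw [Finset.sum_const, Finset.card_univ, nsmul_eq_mul, zero_add]
          field_simp
  have hle : ∀ i ∈ Finset.univ, x i ≤ f x i := by
    intro i _
    have h1 := Finset.single_le_sum (f := fun i => max 0 (x i - f x i))
      (fun _ _ => le_max_left _ _) (Finset.mem_univ i)
    have h2 := le_max_right 0 (x i - f x i)
    linarith
  refine ⟨x, hx, funext fun i => ?_⟩
  have := (Finset.sum_eq_sum_iff_of_le hle).mp (by rw [hx.2, (hmaps hx).2])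
  exact (this i (Finset.mem_univ i)).symm

end Brouwer

/-! ### Schauder's fixed point theorem -/

section Schauder

variable {E : Type*} [NormedAddCommGroup E] [NormedSpace ℝ E]

/-- **Schauder's fixed point theorem.** Partitions of unity subordinate to finite covers of `K` by
small balls reduce it to Brouwer's theorem on a simplex. -/
theorem exists_fixedPoint_of_mapsTo_isCompact {C K : Set E} (hC : Convex ℝ C) (hne : C.Nonempty)
    (hK : IsCompact K) (hKC : K ⊆ C) {F : E → E} (hF : ContinuousOn F C) (hmaps : MapsTo F C K) :
    ∃ x ∈ C, F x = x := by
  have happrox : ∀ ε > 0, ∃ x ∈ C, ‖x - F x‖ ≤ ε := by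
    intro ε hε
    obtain ⟨t, htK, htfin, htcov⟩ := hK.finite_cover_balls hε
    have := htfin.fintype
    have hwpos : ∀ z ∈ K, 0 < ∑ i : t, max 0 (ε - dist z i) := by
      intro z hz
      obtain ⟨y, hy, hzy⟩ := mem_iUnion₂.mp (htcov hz)
      refine Finset.sum_pos' (fun _ _ => le_max_left _ _) ⟨⟨y, hy⟩, Finset.mem_univ _, ?_⟩
      exact lt_max_of_lt_right (sub_pos.mpr hzy)
    obtain ⟨x₀, hx₀⟩ := hne
    have : Nonempty t := by
      obtain ⟨y, hy, -⟩ := mem_iUnion₂.mp (htcov (hmaps hx₀))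
      exact ⟨⟨y, hy⟩⟩
    let p : (t → ℝ) → E := fun l => ∑ i, l i • (i : E)
    have hp : ∀ l ∈ stdSimplex ℝ t, p l ∈ C := fun l hl =>
      hC.sum_mem (fun i _ => hl.1 i) hl.2 fun i _ => hKC (htK i.2)
    have hpc : Continuous p := by fun_prop
    let f : (t → ℝ) → t → ℝ := fun l i =>
      max 0 (ε - dist (F (p l)) i) / ∑ j : t, max 0 (ε - dist (F (p l)) j)
    have hfmaps : MapsTo f (stdSimplex ℝ t) (stdSimplex ℝ t) := by
      intro l hl
      have hpos := hwpos _ (hmaps (hp l hl))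
      refine ⟨fun i => div_nonneg (le_max_left _ _) hpos.le, ?_⟩
      simp only [f]
      rw [← Finset.sum_div, div_self hpos.ne']
    have hfc : ContinuousOn f (stdSimplex ℝ t) := by
      have h1 : ContinuousOn (fun l => F (p l)) (stdSimplex ℝ t) :=
        hF.comp hpc.continuousOn hp
      have h2 : ∀ i : t, ContinuousOn (fun l => max 0 (ε - dist (F (p l)) i)) (stdSimplex ℝ t) :=
        fun i => ContinuousOn.sup continuousOn_const
          (continuousOn_const.sub (continuous_dist.comp_continuousOn (h1.prodMk continuousOn_const)))
      exact continuousOn_pi.mpr fun i => (h2 i).div (continuousOn_finsetSum _ fun j _ => h2 j)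
        fun l hl => (hwpos _ (hmaps (hp l hl))).ne'
    obtain ⟨l, hl, hfl⟩ := exists_fixedPoint_stdSimplex f hfc hfmaps
    refine ⟨p l, hp l hl, ?_⟩
    have heq : p l - F (p l) = ∑ i : t, l i • ((i : E) - F (p l)) := by
      simp only [smul_sub, Finset.sum_sub_distrib, p]
      rw [← Finset.sum_smul, hl.2, one_smul]
    rw [heq]
    calc ‖∑ i : t, l i • ((i : E) - F (p l))‖ ≤ ∑ i : t, l i * ε := by
          refine norm_sum_le_of_le _ fun i _ => ?_
          rw [norm_smul, Real.norm_of_nonneg (hl.1 i)]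
          rcases (hl.1 i).eq_or_lt with h0 | h0
          · simp only [← h0, zero_mul, le_refl]
          · refine mul_le_mul_of_nonneg_left ?_ h0.le
            -- a point of the net with positive weight is `ε`-close to `F (p l)`
            have h1 : 0 < f l i := by rwa [hfl]
            by_contra! h2
            rw [← dist_eq_norm, dist_comm] at h2
            simp only [f] at h1
            rw [max_eq_left (by linarith), zero_div] at h1
            exact lt_irrefl _ h1
      _ = ε := by rw [← Finset.sum_mul, hl.2, one_mul]
  choose x hxC hx using fun k : ℕ => happrox (1 / (k + 1 : ℝ)) (by positivity)
  obtain ⟨y, hyK, φ, hφ, hlim⟩ := hK.tendsto_subseq fun k => hmaps (hxC k)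
  have hxlim : Tendsto (fun k => x (φ k)) atTop (𝓝 y) := by
    have h0 : Tendsto (fun k => x k - F (x k)) atTop (𝓝 0) :=
      squeeze_zero_norm hx tendsto_one_div_add_atTop_nhds_zero_nat
    simpa using (h0.comp hφ.tendsto_atTop).add hlim
  refine ⟨y, hKC hyK, tendsto_nhds_unique ?_ hlim⟩
  exact (hF y (hKC hyK)).tendsto.comp
    (tendsto_nhdsWithin_iff.mpr ⟨hxlim, Eventually.of_forall fun k => hxC _⟩)

/-- A fixed point theorem in polar coordinates `(ρ, b)`: `b` is a fixed direction, and `ρ` is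
either a zero of `η` or an end of the interval towards which `η` points outwards. With `η` the
difference, in either order, of `ρ` and the size of the image of `ρ • b`, this gives the
compressive and the expansive form of Krasnoselskii's theorem. -/
lemma exists_radial_fixedPoint {B K : Set E} (hB : Convex ℝ B) (hne : B.Nonempty)
    (hK : IsCompact K) (hKB : K ⊆ B) {r R : ℝ} (hrR : r ≤ R) {P : ℝ × E → E} {η : ℝ × E → ℝ}
    (hP : ContinuousOn P (Icc r R ×ˢ B)) (hη : ContinuousOn η (Icc r R ×ˢ B))
    (hmaps : MapsTo P (Icc r R ×ˢ B) K) :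
    ∃ ρ ∈ Icc r R, ∃ b ∈ B, P (ρ, b) = b ∧
      (η (ρ, b) = 0 ∨ (ρ = r ∧ η (ρ, b) < 0) ∨ (ρ = R ∧ 0 < η (ρ, b))) := by
  obtain ⟨⟨ρ, b⟩, ⟨hρ, hb⟩, hfix⟩ := exists_fixedPoint_of_mapsTo_isCompact
    (C := Icc r R ×ˢ B) (K := Icc r R ×ˢ K) ((convex_Icc r R).prod hB)
    ((nonempty_Icc.mpr hrR).prod hne) (isCompact_Icc.prod hK) (prod_mono_right hKB)
    (F := fun z => (max r (min R (z.1 + η z)), P z))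
    (ContinuousOn.prodMk (ContinuousOn.sup continuousOn_const
      (ContinuousOn.inf continuousOn_const (continuousOn_fst.add hη))) hP)
    (fun z hz => ⟨⟨le_max_left _ _, max_le hrR (min_le_left _ _)⟩, hmaps hz⟩)
  simp only [Prod.mk.injEq] at hfix
  obtain ⟨h1, h2⟩ := hfix
  refine ⟨ρ, hρ, b, hb, h2, ?_⟩
  rcases lt_trichotomy (η (ρ, b)) 0 with h | h | h
  · refine Or.inr (Or.inl ⟨?_, h⟩)
    by_contra hne
    have hlt : r < ρ := lt_of_le_of_ne hρ.1 (Ne.symm hne)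
    have : max r (min R (ρ + η (ρ, b))) < ρ :=
      max_lt hlt ((min_le_right _ _).trans_lt (by linarith))
    linarith
  · exact Or.inl h
  · refine Or.inr (Or.inr ⟨?_, h⟩)
    by_contra hne
    have hlt : ρ < R := lt_of_le_of_ne hρ.2 hne
    have : ρ < max r (min R (ρ + η (ρ, b))) := lt_max_of_lt_right (lt_min hlt (by linarith))
    linarith

end Schauder

/-! ### Taylor's formula with integral remainder -/

section TaylorIntegral

lemma hasDerivAt_integral_sub_mul {k : ℝ → ℝ} (hk : Continuous k) (t : ℝ) :
    HasDerivAt (fun t => ∫ τ in (0 : ℝ)..t, (t - τ) * k τ) (∫ τ in (0 : ℝ)..t, k τ) t := by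
  have hi : ∀ t, IntervalIntegrable k MeasureTheory.volume 0 t := fun t => hk.intervalIntegrable _ _
  have hk' : Continuous fun τ => τ * k τ := by fun_prop
  have heq : (fun t => ∫ τ in (0 : ℝ)..t, (t - τ) * k τ)
      = fun t => t * (∫ τ in (0 : ℝ)..t, k τ) - ∫ τ in (0 : ℝ)..t, τ * k τ := by
    funext t
    rw [← intervalIntegral.integral_const_mul, ← intervalIntegral.integral_sub
      ((hi t).const_mul t) (hk'.intervalIntegrable _ _)]
    exact intervalIntegral.integral_congr fun τ _ => by ring
  rw [heq]
  have h1 := (hasDerivAt_id t).mul (intervalIntegral.integral_hasDerivAt_right (hi t)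
    (hk.stronglyMeasurableAtFilter _ _) hk.continuousAt)
  have h2 := intervalIntegral.integral_hasDerivAt_right (hk'.intervalIntegrable 0 t)
    (hk'.stronglyMeasurableAtFilter _ _) hk'.continuousAt
  refine (h1.sub h2).congr_deriv ?_
  simp only [id]
  ring

lemma hasDerivAt_integral_of_continuous {k : ℝ → ℝ} (hk : Continuous k) (t : ℝ) :
    HasDerivAt (fun t => ∫ τ in (0 : ℝ)..t, k τ) (k t) t :=
  intervalIntegral.integral_hasDerivAt_right (hk.intervalIntegrable _ _)
    (hk.stronglyMeasurableAtFilter _ _) hk.continuousAt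

lemma eq_left_of_hasDerivWithinAt_zero {u : ℝ → ℝ} {α β : ℝ}
    (hu : ∀ t ∈ Icc α β, HasDerivWithinAt u 0 (Icc α β) t) : ∀ t ∈ Icc α β, u t = u α :=
  constant_of_has_deriv_right_zero (fun t ht => (hu t ht).continuousWithinAt) fun t ht =>
    ((hu t (Ico_subset_Icc_self ht)).mono_of_mem_nhdsWithin (Icc_mem_nhdsGE_of_mem ht))

/-- Taylor's formula with integral remainder for a solution of `u'' = -k`. -/
lemma taylor_of_hasDerivWithinAt {u p k : ℝ → ℝ} (hk : Continuous k) {α β : ℝ}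
    (hu : ∀ t ∈ Icc α β, HasDerivWithinAt u (p t) (Icc α β) t)
    (hp : ∀ t ∈ Icc α β, HasDerivWithinAt p (-k t) (Icc α β) t) {t : ℝ} (ht : t ∈ Icc α β) :
    p t + ∫ τ in (0 : ℝ)..t, k τ = p α + ∫ τ in (0 : ℝ)..α, k τ ∧
    u t + ∫ τ in (0 : ℝ)..t, (t - τ) * k τ
      = u α + (∫ τ in (0 : ℝ)..α, (α - τ) * k τ)
        + (t - α) * (p α + ∫ τ in (0 : ℝ)..α, k τ) := by
  have h1 : ∀ t ∈ Icc α β, p t + ∫ τ in (0 : ℝ)..t, k τ = p α + ∫ τ in (0 : ℝ)..α, k τ :=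
    eq_left_of_hasDerivWithinAt_zero (u := fun t => p t + ∫ τ in (0 : ℝ)..t, k τ)
      fun t ht => ((hp t ht).add (hasDerivAt_integral_of_continuous hk t).hasDerivWithinAt).congr_deriv
        (by ring)
  refine ⟨h1 t ht, ?_⟩
  set c := p α + ∫ τ in (0 : ℝ)..α, k τ
  have h2 := eq_left_of_hasDerivWithinAt_zero
    (u := fun t => u t + (∫ τ in (0 : ℝ)..t, (t - τ) * k τ) - (t - α) * c) (α := α) (β := β)
    (fun t ht => (((hu t ht).add (hasDerivAt_integral_sub_mul hk t).hasDerivWithinAt).sub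
      (((hasDerivWithinAt_id t _).sub_const α).mul_const c)).congr_deriv
        (by rw [h1 t ht]; ring)) t ht
  simp only [sub_self, zero_mul, sub_zero] at h2
  linarith

end TaylorIntegral

/-! ### Potentials of a periodic Green function -/

namespace PeriodicSystem

section Green

variable {T : ℝ} {a : ℝ → ℝ} {G : ℝ → ℝ → ℝ}

/-- The Green function, extended from the square to the plane by projecting both variables
to `[0, T]`. -/
noncomputable def greenExt (hT : 0 < T) (G : ℝ → ℝ → ℝ) (t s : ℝ) : ℝ :=
  G (projIcc 0 T hT.le t) (projIcc 0 T hT.le s)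

lemma greenExt_of_mem (hT : 0 < T) {t s : ℝ} (ht : t ∈ Icc 0 T) (hs : s ∈ Icc 0 T) :
    greenExt hT G t s = G t s := by
  rw [greenExt, projIcc_of_mem _ ht, projIcc_of_mem _ hs]

lemma IsPeriodicGreen.continuous_greenExt (hG : IsPeriodicGreen T a G) (hT : 0 < T) :
    Continuous fun z : ℝ × ℝ => greenExt hT G z.1 z.2 := by
  refine hG.continuousOn.comp_continuous
    (f := fun z : ℝ × ℝ => ((projIcc 0 T hT.le z.1 : ℝ), (projIcc 0 T hT.le z.2 : ℝ))) ?_ ?_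
  · exact (continuous_subtype_val.comp (continuous_projIcc.comp continuous_fst)).prodMk
      (continuous_subtype_val.comp (continuous_projIcc.comp continuous_snd))
  · exact fun z => ⟨Subtype.coe_prop _, Subtype.coe_prop _⟩

/-- Integrated form of the boundary value problem for the Green function: its slope at `0` is
expressed through integrals of the Green function, so that the formula can be integrated in `s`. -/
lemma IsPeriodicGreen.taylor (hG : IsPeriodicGreen T a G) (hT : 0 < T) (ha : Continuous a)
    {s : ℝ} (hs : s ∈ Ioo 0 T) :
    greenExt hT G 0 s = greenExt hT G T s ∧
    ∫ τ in (0 : ℝ)..T, a τ * greenExt hT G τ s = 1 ∧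
    ∃ c : ℝ, ∀ t ∈ Icc 0 T, greenExt hT G t s = greenExt hT G 0 s + c * t + max 0 (t - s)
      - ∫ τ in (0 : ℝ)..t, (t - τ) * (a τ * greenExt hT G τ s) := by
  obtain ⟨p, q, hp, hq, hper, hpq, hjump⟩ := hG.classical s hs
  have hsI : s ∈ Icc 0 T := Ioo_subset_Icc_self hs
  have h0I : (0 : ℝ) ∈ Icc 0 T := left_mem_Icc.mpr hT.le
  have hTI : T ∈ Icc 0 T := right_mem_Icc.mpr hT.le
  set k : ℝ → ℝ := fun τ => a τ * greenExt hT G τ s with hk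
  have hkc : Continuous k := ha.mul
    ((hG.continuous_greenExt hT).comp (continuous_id.prodMk continuous_const))
  have hkp : ∀ t ∈ Icc 0 T, k t = a t * G t s := fun t ht => by
    simp only [hk, greenExt_of_mem hT ht hsI]
  have hleft := fun t (ht : t ∈ Icc 0 s) => taylor_of_hasDerivWithinAt hkc
    (fun t ht => (hp t ht).1)
    (fun t ht => by rw [hkp t ⟨ht.1, ht.2.trans hs.2.le⟩]; exact (hp t ht).2) ht
  have hright := fun t (ht : t ∈ Icc s T) => taylor_of_hasDerivWithinAt hkc
    (fun t ht => (hq t ht).1)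
    (fun t ht => by rw [hkp t ⟨hs.1.le.trans ht.1, ht.2⟩]; exact (hq t ht).2) ht
  simp only [intervalIntegral.integral_same, add_zero, sub_zero] at hleft
  have hs1 := hleft s (right_mem_Icc.mpr hs.1.le)
  have hT1 := hright T (right_mem_Icc.mpr hs.2.le)
  refine ⟨?_, ?_, p 0, fun t ht => ?_⟩
  · rw [greenExt_of_mem hT h0I hsI, greenExt_of_mem hT hTI hsI, hper]
  · linarith [hT1.1, hs1.1]
  · rw [greenExt_of_mem hT h0I hsI, greenExt_of_mem hT ht hsI]
    rcases le_total t s with h | h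
    · rw [max_eq_left (by linarith)]
      linarith [(hleft t ⟨ht.1, h⟩).2]
    · rw [max_eq_right (by linarith)]
      have h1 := (hright t ⟨h, ht.2⟩).2
      have h2 : q s + ∫ τ in (0 : ℝ)..s, k τ = p 0 + 1 := by linarith [hs1.1]
      rw [h2] at h1
      linarith [hs1.2]

/-- The potential of `h` with respect to the Green function. -/
noncomputable def potential (hT : 0 < T) (G : ℝ → ℝ → ℝ) (h : ℝ → ℝ) (t : ℝ) : ℝ :=
  ∫ s in (0 : ℝ)..T, greenExt hT G t s * h s

lemma IsPeriodicGreen.continuous_potential (hG : IsPeriodicGreen T a G) (hT : 0 < T)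
    {h : ℝ → ℝ} (hh : Continuous h) : Continuous (potential hT G h) := by
  refine intervalIntegral.continuous_parametric_intervalIntegral_of_continuous ?_ continuous_const
  exact (hG.continuous_greenExt hT).mul (hh.comp continuous_snd)

/-- Only the open interval matters, and the Green function is only constrained there. -/
lemma integral_congr_Ioo {T : ℝ} (hT : 0 < T) {u v : ℝ → ℝ} (h : ∀ s ∈ Ioo 0 T, u s = v s) :
    ∫ s in (0 : ℝ)..T, u s = ∫ s in (0 : ℝ)..T, v s := by
  rw [intervalIntegral.integral_of_le hT.le, intervalIntegral.integral_of_le hT.le,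
    MeasureTheory.integral_Ioc_eq_integral_Ioo, MeasureTheory.integral_Ioc_eq_integral_Ioo]
  exact MeasureTheory.setIntegral_congr_fun measurableSet_Ioo h

lemma integral_swap_of_continuous {F : ℝ → ℝ → ℝ} (hF : Continuous (Function.uncurry F))
    (α β γ δ : ℝ) :
    ∫ x in α..β, ∫ y in γ..δ, F x y = ∫ y in γ..δ, ∫ x in α..β, F x y := by
  refine MeasureTheory.intervalIntegral_intervalIntegral_swap ?_
  refine MeasureTheory.IntegrableOn.mono_set (t := uIcc α β ×ˢ uIcc γ δ) ?_
    (prod_mono uIoc_subset_uIcc uIoc_subset_uIcc)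
  exact hF.continuousOn.integrableOn_compact (isCompact_uIcc.prod isCompact_uIcc)

/-- Integrated form of the periodic boundary value problem for the potential of `h`. -/
lemma IsPeriodicGreen.potential_taylor (hG : IsPeriodicGreen T a G) (hT : 0 < T)
    (ha : Continuous a) {h : ℝ → ℝ} (hh : Continuous h) :
    potential hT G h 0 = potential hT G h T ∧
    ∫ τ in (0 : ℝ)..T, (h τ - a τ * potential hT G h τ) = 0 ∧
    ∃ c : ℝ, ∀ t ∈ Icc 0 T, potential hT G h t = potential hT G h 0 + c * t
      + ∫ τ in (0 : ℝ)..t, (t - τ) * (h τ - a τ * potential hT G h τ) := by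
  have hGc := hG.continuous_greenExt hT
  have hX := hG.continuous_potential hT hh
  have hGs : ∀ t, Continuous fun s => greenExt hT G t s := fun t =>
    hGc.comp (continuous_const.prodMk continuous_id)
  -- Fubini, with a weight `b` in the outer variable
  have hswap : ∀ (b : ℝ → ℝ), Continuous b → ∀ t,
      ∫ s in (0 : ℝ)..T, (∫ τ in (0 : ℝ)..t, b τ * (a τ * greenExt hT G τ s)) * h s
        = ∫ τ in (0 : ℝ)..t, b τ * (a τ * potential hT G h τ) := by
    intro b hb t
    simp only [← intervalIntegral.integral_mul_const]
    rw [integral_swap_of_continuous (F := fun s τ => b τ * (a τ * greenExt hT G τ s) * h s)]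
    · refine intervalIntegral.integral_congr fun τ _ => ?_
      simp only [potential]
      rw [← intervalIntegral.integral_const_mul, ← intervalIntegral.integral_const_mul]
      exact intervalIntegral.integral_congr fun s _ => by ring
    · exact ((hb.comp continuous_snd).mul ((ha.comp continuous_snd).mul
        (hGc.comp continuous_swap))).mul (hh.comp continuous_fst)
  have hmean : ∫ s in (0 : ℝ)..T, h s = ∫ τ in (0 : ℝ)..T, a τ * potential hT G h τ := by
    have h1 := hswap (fun _ => 1) continuous_const T
    simp only [one_mul] at h1
    rw [← h1]
    exact integral_congr_Ioo hT fun s hs => by rw [(hG.taylor hT ha hs).2.1, one_mul]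
  have haX : Continuous fun τ => a τ * potential hT G h τ := ha.mul hX
  have hRc : ∀ t, Continuous fun s =>
      ∫ τ in (0 : ℝ)..t, (t - τ) * (a τ * greenExt hT G τ s) := fun t => by
    refine intervalIntegral.continuous_parametric_intervalIntegral_of_continuous ?_ continuous_const
    exact (continuous_const.sub continuous_snd).mul ((ha.comp continuous_snd).mul
        (hGc.comp continuous_swap))
  refine ⟨?_, ?_, ?_⟩
  · exact integral_congr_Ioo hT fun s hs => by rw [(hG.taylor hT ha hs).1]
  · rw [intervalIntegral.integral_sub (hh.intervalIntegrable _ _) (haX.intervalIntegrable _ _),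
      hmean, sub_self]
  · -- the slope of `G(·, s)` at `0`, solved for from the formula at `t = T`
    set c : ℝ → ℝ := fun s =>
      ((∫ τ in (0 : ℝ)..T, (T - τ) * (a τ * greenExt hT G τ s)) - (T - s)) / T with hc
    have hcc : Continuous c := ((hRc T).sub (continuous_const.sub continuous_id)).div_const T
    have hGt : ∀ s ∈ Ioo 0 T, ∀ t ∈ Icc 0 T, greenExt hT G t s
        = greenExt hT G 0 s + c s * t + max 0 (t - s)
          - ∫ τ in (0 : ℝ)..t, (t - τ) * (a τ * greenExt hT G τ s) := by
      intro s hs t ht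
      obtain ⟨h0T, -, c', hc'⟩ := hG.taylor hT ha hs
      have h1 := hc' T (right_mem_Icc.mpr hT.le)
      rw [max_eq_right (by linarith [hs.2]), h0T] at h1
      have h2 : c' = c s := by
        rw [hc, eq_div_iff hT.ne']
        linarith
      rw [← h2]
      exact hc' t ht
    refine ⟨∫ s in (0 : ℝ)..T, c s * h s, fun t ht => ?_⟩
    have hmax : ∫ s in (0 : ℝ)..T, max 0 (t - s) * h s = ∫ s in (0 : ℝ)..t, (t - s) * h s := by
      have hmc : Continuous fun s => max 0 (t - s) * h s :=
        (continuous_const.max (continuous_const.sub continuous_id)).mul hh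
      rw [← intervalIntegral.integral_add_adjacent_intervals (b := t)
        (hmc.intervalIntegrable _ _) (hmc.intervalIntegrable _ _)]
      have h1 : ∫ s in t..T, max 0 (t - s) * h s = 0 := by
        rw [intervalIntegral.integral_congr (g := fun _ => 0), intervalIntegral.integral_zero]
        intro s hs
        rw [uIcc_of_le ht.2] at hs
        simp only [max_eq_left (sub_nonpos.mpr hs.1), zero_mul]
      rw [h1, add_zero]
      refine intervalIntegral.integral_congr fun s hs => ?_
      rw [uIcc_of_le ht.1] at hs
      simp only [max_eq_right (sub_nonneg.mpr hs.2)]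
    have hsplit : potential hT G h t = potential hT G h 0 + (∫ s in (0 : ℝ)..T, c s * h s) * t
        + (∫ s in (0 : ℝ)..T, max 0 (t - s) * h s)
        - ∫ s in (0 : ℝ)..T, (∫ τ in (0 : ℝ)..t, (t - τ) * (a τ * greenExt hT G τ s)) * h s := by
      have i0 : IntervalIntegrable (fun s => greenExt hT G 0 s * h s) MeasureTheory.volume 0 T :=
        ((hGs 0).mul hh).intervalIntegrable _ _
      have i1 : IntervalIntegrable (fun s => c s * h s * t) MeasureTheory.volume 0 T :=
        ((hcc.mul hh).mul continuous_const).intervalIntegrable _ _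
      have i2 : IntervalIntegrable (fun s => max 0 (t - s) * h s) MeasureTheory.volume 0 T :=
        ((continuous_const.max (continuous_const.sub continuous_id)).mul hh).intervalIntegrable _ _
      have i3 : IntervalIntegrable
          (fun s => (∫ τ in (0 : ℝ)..t, (t - τ) * (a τ * greenExt hT G τ s)) * h s)
          MeasureTheory.volume 0 T := ((hRc t).mul hh).intervalIntegrable _ _
      simp only [potential]
      rw [← intervalIntegral.integral_mul_const, ← intervalIntegral.integral_add i0 i1,
        ← intervalIntegral.integral_add (i0.add i1) i2,
        ← intervalIntegral.integral_sub ((i0.add i1).add i2) i3]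
      exact integral_congr_Ioo hT fun s hs => by rw [hGt s hs t ht]; ring
    rw [hsplit, hmax, hswap (fun τ => t - τ) (continuous_const.sub continuous_id) t]
    have hlin : Continuous fun τ => (t - τ) * h τ := by fun_prop
    have hlin' : Continuous fun τ => (t - τ) * (a τ * potential hT G h τ) := by fun_prop
    rw [add_sub_assoc, ← intervalIntegral.integral_sub (hlin.intervalIntegrable _ _)
      (hlin'.intervalIntegrable _ _)]
    congr 1
    exact intervalIntegral.integral_congr fun τ _ => by ring

end Green

end PeriodicSystem

/-! ### Periodic solutions of the linear equation -/

namespace PeriodicSystem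

section PeriodicExtension

variable {T : ℝ} {a : ℝ → ℝ} {G : ℝ → ℝ → ℝ}

lemma exists_periodic_extension {β : Type*} [TopologicalSpace β] (hT : 0 < T) {u : ℝ → β}
    (hu : Continuous u) (h0T : u 0 = u T) :
    ∃ v : ℝ → β, Continuous v ∧ Function.Periodic v T ∧ ∀ t ∈ Icc 0 T, v t = u t := by
  have : Fact (0 < T) := ⟨hT⟩
  refine ⟨fun t => AddCircle.liftIco T 0 u (t : AddCircle T),
    (AddCircle.liftIco_zero_continuous h0T hu.continuousOn).comp (AddCircle.continuous_mk' T),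
    fun t => by simp only [AddCircle.coe_add_period], fun t ht => ?_⟩
  rcases ht.2.eq_or_lt with rfl | h
  · have h1 : ((t : ℝ) : AddCircle t) = ((0 : ℝ) : AddCircle t) := by simp
    simp only [h1]
    rw [AddCircle.liftIco_zero_coe_apply ⟨le_refl 0, hT⟩, h0T]
  · exact AddCircle.liftIco_zero_coe_apply ⟨ht.1, h⟩

lemma eq_of_periodic_of_eqOn {β : Type*} (hT : 0 < T) {u v : ℝ → β} (hu : Function.Periodic u T)
    (hv : Function.Periodic v T) (h : ∀ t ∈ Icc 0 T, u t = v t) (t : ℝ) : u t = v t := by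
  have huv : Function.Periodic (fun t => (u t, v t)) T := fun t => by simp only [hu t, hv t]
  obtain ⟨s, hs, hst⟩ := huv.exists_mem_Ico₀ hT t
  simp only [Prod.mk.injEq] at hst
  rw [hst.1, hst.2, h s (Ico_subset_Icc_self hs)]

/-- The potential of a periodic function extends to a periodic solution of the differential
equation on the whole line. -/
theorem IsPeriodicGreen.exists_periodic_solution (hG : IsPeriodicGreen T a G) (hT : 0 < T)
    (ha : Continuous a) (haT : Function.Periodic a T) {h : ℝ → ℝ} (hh : Continuous h)
    (hhT : Function.Periodic h T) :
    ∃ y : ℝ → ℝ, ContDiff ℝ 2 y ∧ Function.Periodic y T ∧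
      (∀ t ∈ Icc 0 T, y t = potential hT G h t) ∧
      ∀ t, deriv (deriv y) t + a t * y t = h t := by
  obtain ⟨h0T, hmean, c, hc⟩ := hG.potential_taylor hT ha hh
  obtain ⟨X, hXc, hXT, hX⟩ := exists_periodic_extension hT (hG.continuous_potential hT hh) h0T
  set w : ℝ → ℝ := fun t => h t - a t * X t with hw
  have hwc : Continuous w := hh.sub (ha.mul hXc)
  have hwT : Function.Periodic w T := fun t => by simp only [hw, hhT t, haT t, hXT t]
  have hwint : ∀ t ∈ Icc 0 T, ∀ b : ℝ → ℝ, ∫ τ in (0 : ℝ)..t, b τ * w τ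
      = ∫ τ in (0 : ℝ)..t, b τ * (h τ - a τ * potential hT G h τ) := by
    intro t ht b
    refine intervalIntegral.integral_congr fun τ hτ => ?_
    rw [uIcc_of_le ht.1] at hτ
    simp only [hw, hX τ ⟨hτ.1, hτ.2.trans ht.2⟩]
  have hw0 : ∫ τ in (0 : ℝ)..T, w τ = 0 := by
    have := hwint T (right_mem_Icc.mpr hT.le) fun _ => 1
    simp only [one_mul] at this
    rw [this, hmean]
  set y : ℝ → ℝ := fun t => potential hT G h 0 + c * t + ∫ τ in (0 : ℝ)..t, (t - τ) * w τ with hy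
  have hyX : ∀ t ∈ Icc 0 T, y t = potential hT G h t := by
    intro t ht
    rw [hc t ht, ← hwint t ht]
  have hd : ∀ t, HasDerivAt y (c + ∫ τ in (0 : ℝ)..t, w τ) t := fun t =>
    ((((hasDerivAt_id t).const_mul c).const_add _).add
      (hasDerivAt_integral_sub_mul hwc t)).congr_deriv (by ring)
  have hdd : ∀ t, HasDerivAt (fun t => c + ∫ τ in (0 : ℝ)..t, w τ) (w t) t := fun t =>
    (hasDerivAt_integral_of_continuous hwc t).const_add c
  have hd' : deriv y = fun t => c + ∫ τ in (0 : ℝ)..t, w τ := funext fun t => (hd t).deriv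
  have hdd' : deriv (deriv y) = w := by rw [hd']; exact funext fun t => (hdd t).deriv
  have hyT : Function.Periodic y T := by
    have hz : ∀ t, HasDerivAt (fun t => y (t + T) - y t) 0 t := fun t => by
      refine (((hd (t + T)).comp_add_const t T).sub (hd t)).congr_deriv ?_
      rw [hwT.intervalIntegral_add_eq_add 0 t fun _ _ => hwc.intervalIntegrable _ _, zero_add, hw0]
      ring
    intro t
    have h1 := is_const_of_deriv_eq_zero (fun t => (hz t).differentiableAt)
      (fun t => (hz t).deriv) t 0
    simp only [zero_add] at h1
    rw [hyX T (right_mem_Icc.mpr hT.le), hyX 0 (left_mem_Icc.mpr hT.le), h0T, sub_self] at h1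
    linarith
  refine ⟨y, ?_, hyT, hyX, fun t => ?_⟩
  · rw [show (2 : WithTop ℕ∞) = 1 + 1 from rfl, contDiff_succ_iff_deriv]
    refine ⟨fun t => (hd t).differentiableAt, by simp, ?_⟩
    rw [contDiff_one_iff_deriv, hdd']
    exact ⟨fun t => hd' ▸ (hdd t).differentiableAt, hwc⟩
  · have hyX' := eq_of_periodic_of_eqOn hT hyT hXT (fun t ht => (hyX t ht).trans (hX t ht).symm) t
    rw [hdd', hyX', hw]
    ring

end PeriodicExtension

end PeriodicSystem

/-! ### Compactness of equicontinuous sets -/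

section Compactness

/-- A pointwise form of the Arzelà–Ascoli theorem: a pointwise closed and bounded set of functions
with a common modulus of continuity is compact for uniform convergence. -/
lemma isCompact_setOf_coe_mem {X ι : Type*} [TopologicalSpace X] [Fintype ι]
    {Z : Set (X → ι → ℝ)} (hZ : IsClosed Z) {L : ℝ} (hL : ∀ v ∈ Z, ∀ t i, |v t i| ≤ L)
    {ω : X → X → ℝ} (hω : ∀ t, Tendsto (ω t) (𝓝 t) (𝓝 0))
    (hmod : ∀ v ∈ Z, ∀ t t' i, |v t i - v t' i| ≤ ω t t') :
    IsCompact {b : C(X, ι → ℝ) | ⇑b ∈ Z} := by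
  have hdist : ∀ v ∈ Z, ∀ t t', dist (v t) (v t') ≤ |ω t t'| := fun v hv t t' =>
    (dist_pi_le_iff (abs_nonneg _)).mpr fun i => (hmod v hv t t' i).trans (le_abs_self _)
  have hω' : ∀ t, Tendsto (fun t' => |ω t t'|) (𝓝 t) (𝓝 0) := fun t => by
    simpa using (hω t).abs
  refine ArzelaAscoli.isCompact_of_equicontinuous _ ?_ ?_
  · have himg : ContinuousMap.toFun '' {b : C(X, ι → ℝ) | ⇑b ∈ Z} = Z := by
      ext v
      constructor
      · rintro ⟨b, hb, rfl⟩
        exact hb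
      · intro hv
        refine ⟨⟨v, continuous_iff_continuousAt.mpr fun t => ?_⟩, hv, rfl⟩
        rw [ContinuousAt, tendsto_iff_dist_tendsto_zero]
        refine squeeze_zero (fun _ => dist_nonneg) (fun t' => ?_) (hω' t)
        rw [dist_comm]
        exact hdist v hv t t'
    rw [himg]
    refine (isCompact_univ_pi fun _ : X => isCompact_univ_pi fun _ : ι =>
      isCompact_Icc (a := -L) (b := L)).of_isClosed_subset hZ fun v hv => ?_
    simp only [Set.mem_pi, mem_univ, forall_const]
    exact fun t i => abs_le.mp (hL v hv t i)
  · intro t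
    exact Metric.equicontinuousAt_of_continuity_modulus _ (hω' t) _
      (Eventually.of_forall fun t' b => hdist b b.2 t t')

end Compactness

/-! ### Hammerstein operators on a cone -/

namespace PeriodicSystem

section Cone

variable {n : ℕ} {T m M : ℝ}

/-- Vectors of the nonnegative orthant whose size lies between `(m / M) r` and `(M / m) R`: the
values that a function in the cone of functions with `m u_i(t) ≤ M u_i(t')` can take when its
size at the initial time is between `r` and `R`. -/
def shell (n : ℕ) (m M r R : ℝ) : Set (Fin n → ℝ) :=
  {x | (∀ i, 0 ≤ x i) ∧ m * r ≤ M * sumNorm x ∧ m * sumNorm x ≤ M * R}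

lemma sumNorm_eq_sum {x : Fin n → ℝ} (hx : ∀ i, 0 ≤ x i) : sumNorm x = ∑ i, x i :=
  Finset.sum_congr rfl fun i _ => abs_of_nonneg (hx i)

lemma continuous_sumNorm : Continuous (sumNorm : (Fin n → ℝ) → ℝ) :=
  continuous_finsetSum _ fun i _ => (continuous_apply i).abs

lemma abs_apply_le_sumNorm (x : Fin n → ℝ) (i : Fin n) : |x i| ≤ sumNorm x :=
  Finset.single_le_sum (f := fun i => |x i|) (fun _ _ => abs_nonneg _) (Finset.mem_univ i)

lemma isCompact_shell (hm : 0 < m) (r R : ℝ) : IsCompact (shell n m M r R) := by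
  refine (isCompact_univ_pi fun _ : Fin n => isCompact_Icc (a := (0 : ℝ))
    (b := M * R / m)).of_isClosed_subset ?_ fun x hx => ?_
  · simp only [shell, Set.ofPred_and, Set.ofPred_forall]
    exact (isClosed_iInter fun i => isClosed_le continuous_const (continuous_apply i)).inter
      ((isClosed_le continuous_const (continuous_const.mul continuous_sumNorm)).inter
        (isClosed_le (continuous_const.mul continuous_sumNorm) continuous_const))
  · simp only [Set.mem_pi, mem_univ, forall_const]
    refine fun i => ⟨hx.1 i, ?_⟩
    rw [le_div_iff₀ hm]
    have h1 := (le_abs_self _).trans (abs_apply_le_sumNorm x i)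
    nlinarith [hx.2.2]

lemma shell_subset_puncturedOrthant (hm : 0 < m) (hM : 0 < M) {r : ℝ} (hr : 0 < r) (R : ℝ) :
    shell n m M r R ⊆ puncturedOrthant n := fun _ hx =>
  ⟨hx.1, pos_of_mul_pos_right ((mul_pos hm hr).trans_le hx.2.1) hM.le⟩

/-- The base of the cone of nonnegative functions with `m u_i(t) ≤ M u_i(t')`, cut out by the
linear functional `∑ u_i(0)`. -/
def coneBase (n : ℕ) (hT : 0 < T) (m M : ℝ) : Set (Icc 0 T → Fin n → ℝ) :=
  {b | (∀ t i, 0 ≤ b t i) ∧ (∀ t t' i, m * b t i ≤ M * b t' i) ∧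
    ∑ i, b ⟨0, left_mem_Icc.mpr hT.le⟩ i = 1}

lemma isClosed_coneBase (hT : 0 < T) : IsClosed (coneBase n hT m M) := by
  have hc : ∀ (t : Icc 0 T) (i : Fin n), Continuous fun b : Icc 0 T → Fin n → ℝ => b t i :=
    fun t i => (continuous_apply i).comp (continuous_apply t)
  simp only [coneBase, Set.ofPred_and, Set.ofPred_forall]
  exact (isClosed_iInter fun t => isClosed_iInter fun i =>
      isClosed_le continuous_const (hc t i)).inter
    ((isClosed_iInter fun t => isClosed_iInter fun t' => isClosed_iInter fun i =>
      isClosed_le (continuous_const.mul (hc t i)) (continuous_const.mul (hc t' i))).inter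
    (isClosed_eq (continuous_finsetSum _ fun i _ => hc _ i) continuous_const))

lemma smul_mem_shell (hT : 0 < T) {b : Icc 0 T → Fin n → ℝ} (hb : b ∈ coneBase n hT m M)
    {r R ρ : ℝ} (hm : 0 < m) (hM : 0 < M) (hr : 0 < r) (hρ : ρ ∈ Icc r R) (t : Icc 0 T) :
    ρ • b t ∈ shell n m M r R := by
  have hρ0 : 0 < ρ := hr.trans_le hρ.1
  have hnn : ∀ i, 0 ≤ (ρ • b t) i := fun i => mul_nonneg hρ0.le (hb.1 t i)
  have h1 : m * 1 ≤ M * ∑ i, b t i := by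
    rw [← hb.2.2, Finset.mul_sum, Finset.mul_sum]
    exact Finset.sum_le_sum fun i _ => hb.2.1 _ _ i
  have h2 : m * ∑ i, b t i ≤ M * 1 := by
    rw [← hb.2.2, Finset.mul_sum, Finset.mul_sum]
    exact Finset.sum_le_sum fun i _ => hb.2.1 _ _ i
  have h3 : sumNorm (ρ • b t) = ρ * ∑ i, b t i := by
    rw [sumNorm_eq_sum hnn, Finset.mul_sum]
    rfl
  refine ⟨hnn, ?_, ?_⟩
  · rw [h3]
    nlinarith [hρ.1, mul_le_mul_of_nonneg_left h1 hρ0.le]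
  · rw [h3]
    nlinarith [hρ.2, mul_le_mul_of_nonneg_left h2 hρ0.le]

variable {k : Fin n → ℝ → ℝ → ℝ} {H : Fin n → ℝ → (Fin n → ℝ) → ℝ}

lemma continuous_hammerstein_integrand (hk : ∀ i, Continuous fun z : ℝ × ℝ => k i z.1 z.2)
    (hH : ∀ i, Continuous fun z : ℝ × (Fin n → ℝ) => H i z.1 z.2) (hT : 0 < T) (i : Fin n) :
    Continuous fun z : (C(Icc 0 T, Fin n → ℝ) × Icc 0 T) × ℝ =>
      k i z.1.2 z.2 * H i z.2 (z.1.1 (projIcc 0 T hT.le z.2)) := by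
  refine ((hk i).comp ((continuous_subtype_val.comp
    (continuous_snd.comp continuous_fst)).prodMk continuous_snd)).mul
    ((hH i).comp (continuous_snd.prodMk ?_))
  exact (continuous_fst.comp continuous_fst).eval
    ((continuous_projIcc (h := hT.le)).comp continuous_snd)

lemma continuous_hammerstein_integral (hk : ∀ i, Continuous fun z : ℝ × ℝ => k i z.1 z.2)
    (hH : ∀ i, Continuous fun z : ℝ × (Fin n → ℝ) => H i z.1 z.2) (hT : 0 < T) (i : Fin n) :
    Continuous fun z : C(Icc 0 T, Fin n → ℝ) × Icc 0 T =>
      ∫ s in (0 : ℝ)..T, k i z.2 s * H i s (z.1 (projIcc 0 T hT.le s)) :=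
  intervalIntegral.continuous_parametric_intervalIntegral_of_continuous
    (f := fun (z : C(Icc 0 T, Fin n → ℝ) × Icc 0 T) (s : ℝ) =>
      k i z.2 s * H i s (z.1 (projIcc 0 T hT.le s)))
    (continuous_hammerstein_integrand hk hH hT i) continuous_const

/-- The Hammerstein operator with kernels `k i` and nonlinearities `H i`, on the continuous
functions on `[0, T]`. -/
noncomputable def hammerstein (hk : ∀ i, Continuous fun z : ℝ × ℝ => k i z.1 z.2)
    (hH : ∀ i, Continuous fun z : ℝ × (Fin n → ℝ) => H i z.1 z.2) (hT : 0 < T)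
    (u : C(Icc 0 T, Fin n → ℝ)) : C(Icc 0 T, Fin n → ℝ) where
  toFun t i := ∫ s in (0 : ℝ)..T, k i t s * H i s (u (projIcc 0 T hT.le s))
  continuous_toFun := continuous_pi fun i => (continuous_hammerstein_integral hk hH hT i).comp
    (continuous_const.prodMk continuous_id : Continuous fun t : Icc 0 T => (u, t))

variable (hk : ∀ i, Continuous fun z : ℝ × ℝ => k i z.1 z.2)
  (hH : ∀ i, Continuous fun z : ℝ × (Fin n → ℝ) => H i z.1 z.2) (hT : 0 < T)

lemma hammerstein_apply (u : C(Icc 0 T, Fin n → ℝ)) (t : Icc 0 T) (i : Fin n) :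
    hammerstein hk hH hT u t i
      = ∫ s in (0 : ℝ)..T, k i t s * H i s (u (projIcc 0 T hT.le s)) := rfl

lemma continuous_hammerstein : Continuous (hammerstein hk hH hT) := by
  exact ContinuousMap.continuous_of_continuous_uncurry _
    (continuous_pi fun i => continuous_hammerstein_integral hk hH hT i)

/-- The kernel as a continuous family of functions on `[0, T]`; its modulus of continuity is
shared by all normalized images of the Hammerstein operator. -/
def kernelCurry (hk : ∀ i, Continuous fun z : ℝ × ℝ => k i z.1 z.2) (T : ℝ) (i : Fin n) :
    C(Icc 0 T, C(Icc 0 T, ℝ)) :=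
  ContinuousMap.curry ⟨fun z : Icc 0 T × Icc 0 T => k i z.1 z.2,
    (hk i).comp ((continuous_subtype_val.comp continuous_fst).prodMk
      (continuous_subtype_val.comp continuous_snd))⟩

lemma continuous_source (hH : ∀ i, Continuous fun z : ℝ × (Fin n → ℝ) => H i z.1 z.2) (hT : 0 < T)
    (u : C(Icc 0 T, Fin n → ℝ)) (i : Fin n) :
    Continuous fun s => H i s (u (projIcc 0 T hT.le s)) :=
  (hH i).comp (continuous_id.prodMk (u.continuous.comp continuous_projIcc))

lemma continuous_kernel_right (hk : ∀ i, Continuous fun z : ℝ × ℝ => k i z.1 z.2) (i : Fin n)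
    (t : ℝ) : Continuous fun s => k i t s :=
  (hk i).comp (continuous_const.prodMk continuous_id)

variable {u : C(Icc 0 T, Fin n → ℝ)}

lemma le_hammerstein (hkm : ∀ i t s, m ≤ k i t s)
    (hu : ∀ i, ∀ s ∈ Icc 0 T, 0 ≤ H i s (u (projIcc 0 T hT.le s))) (t : Icc 0 T) (i : Fin n) :
    m * (∫ s in (0 : ℝ)..T, H i s (u (projIcc 0 T hT.le s))) ≤ hammerstein hk hH hT u t i := by
  have hc := continuous_source hH hT u i
  rw [hammerstein_apply, ← intervalIntegral.integral_const_mul]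
  exact intervalIntegral.integral_mono_on hT.le ((continuous_const.mul hc).intervalIntegrable _ _)
    (((continuous_kernel_right hk i t).mul hc).intervalIntegrable _ _)
    fun s hs => mul_le_mul_of_nonneg_right (hkm i t s) (hu i s hs)

lemma hammerstein_le (hkM : ∀ i t s, k i t s ≤ M)
    (hu : ∀ i, ∀ s ∈ Icc 0 T, 0 ≤ H i s (u (projIcc 0 T hT.le s))) (t : Icc 0 T) (i : Fin n) :
    hammerstein hk hH hT u t i ≤ M * ∫ s in (0 : ℝ)..T, H i s (u (projIcc 0 T hT.le s)) := by
  have hc := continuous_source hH hT u i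
  rw [hammerstein_apply, ← intervalIntegral.integral_const_mul]
  exact intervalIntegral.integral_mono_on hT.le
    (((continuous_kernel_right hk i t).mul hc).intervalIntegrable _ _)
    ((continuous_const.mul hc).intervalIntegrable _ _)
    fun s hs => mul_le_mul_of_nonneg_right (hkM i t s) (hu i s hs)

lemma abs_hammerstein_sub_le
    (hu : ∀ i, ∀ s ∈ Icc 0 T, 0 ≤ H i s (u (projIcc 0 T hT.le s))) (t t' : Icc 0 T) (i : Fin n) :
    |hammerstein hk hH hT u t i - hammerstein hk hH hT u t' i|
      ≤ ‖kernelCurry hk T i t - kernelCurry hk T i t'‖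
        * ∫ s in (0 : ℝ)..T, H i s (u (projIcc 0 T hT.le s)) := by
  have hc := continuous_source hH hT u i
  have hi : ∀ t, IntervalIntegrable (fun s => k i t s * H i s (u (projIcc 0 T hT.le s)))
      MeasureTheory.volume 0 T := fun t =>
    ((continuous_kernel_right hk i t).mul hc).intervalIntegrable _ _
  rw [hammerstein_apply, hammerstein_apply, ← intervalIntegral.integral_const_mul,
    ← intervalIntegral.integral_sub (hi t) (hi t'), ← Real.norm_eq_abs]
  refine intervalIntegral.norm_integral_le_of_norm_le hT.le ?_
    ((continuous_const.mul hc).intervalIntegrable _ _)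
  refine MeasureTheory.ae_of_all _ fun s hs => ?_
  have hs' : s ∈ Icc 0 T := Ioc_subset_Icc_self hs
  rw [← sub_mul, norm_mul, Real.norm_of_nonneg (hu i s hs')]
  exact mul_le_mul_of_nonneg_right
    ((kernelCurry hk T i t - kernelCurry hk T i t').norm_coe_le_norm ⟨s, hs'⟩) (hu i s hs')

/-- **Krasnoselskii's fixed point theorem** for Hammerstein operators with kernels between two
positive constants `m` and `M`. With `ε = 1` the conditions at the ends `r` and `R` say that the
operator compresses the conical shell, with `ε = -1` that it expands it. -/
theorem exists_hammerstein_fixedPoint (hn : 1 ≤ n) (hm : 0 < m) (hM : 0 < M)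
    (hkm : ∀ i t s, m ≤ k i t s) (hkM : ∀ i t s, k i t s ≤ M) {r R : ℝ} (hr : 0 < r) (hrR : r ≤ R)
    (hpos : ∀ i, ∀ s ∈ Icc 0 T, ∀ x ∈ shell n m M r R, 0 < H i s x) {ε : ℝ} (hε : ε ≠ 0)
    (hrε : ∀ u : C(Icc 0 T, Fin n → ℝ), (∀ t, u t ∈ shell n m M r r) →
      0 ≤ ε * (∑ i, hammerstein hk hH hT u ⟨0, left_mem_Icc.mpr hT.le⟩ i - r))
    (hRε : ∀ u : C(Icc 0 T, Fin n → ℝ), (∀ t, u t ∈ shell n m M R R) →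
      ε * (∑ i, hammerstein hk hH hT u ⟨0, left_mem_Icc.mpr hT.le⟩ i - R) ≤ 0) :
    ∃ u : C(Icc 0 T, Fin n → ℝ), hammerstein hk hH hT u = u ∧ (∀ t, u t ∈ shell n m M r R) ∧
      ∑ i, u ⟨0, left_mem_Icc.mpr hT.le⟩ i ∈ Icc r R := by
  set t₀ : Icc 0 T := ⟨0, left_mem_Icc.mpr hT.le⟩ with ht₀
  set A := hammerstein hk hH hT with hA
  have hAc : Continuous A := continuous_hammerstein hk hH hT
  set B : Set C(Icc 0 T, Fin n → ℝ) := {b | ⇑b ∈ coneBase n hT m M} with hB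
  set ω : Icc 0 T → Icc 0 T → ℝ := fun t t' =>
    (∑ i, ‖kernelCurry hk T i t - kernelCurry hk T i t'‖) / m with hω
  set Z : Set (Icc 0 T → Fin n → ℝ) :=
    coneBase n hT m M ∩ {v | ∀ t t' i, |v t i - v t' i| ≤ ω t t'} with hZ
  set θ : ℝ × C(Icc 0 T, Fin n → ℝ) → ℝ := fun z => ∑ i, A (z.1 • z.2) t₀ i with hθ
  set I : C(Icc 0 T, Fin n → ℝ) → Fin n → ℝ := fun u i =>
    ∫ s in (0 : ℝ)..T, H i s (u (projIcc 0 T hT.le s)) with hI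
  have hBne : B.Nonempty := by
    refine ⟨ContinuousMap.const _ fun _ => 1 / (n : ℝ), ?_⟩
    have hn0 : (0 : ℝ) < n := by exact_mod_cast hn
    have hmM : m ≤ M := (hkm ⟨0, hn⟩ 0 0).trans (hkM ⟨0, hn⟩ 0 0)
    refine ⟨fun t i => ?_, fun t t' i => ?_, ?_⟩
    · simp only [ContinuousMap.const_apply]
      positivity
    · simp only [ContinuousMap.const_apply]
      gcongr
    · simp [hn0.ne']
  have hBconv : Convex ℝ B := by
    intro b hb b' hb' x y hx hy hxy
    refine ⟨fun t i => ?_, fun t t' i => ?_, ?_⟩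
    · exact add_nonneg (mul_nonneg hx (hb.1 t i)) (mul_nonneg hy (hb'.1 t i))
    · have h1 := mul_le_mul_of_nonneg_left (hb.2.1 t t' i) hx
      have h2 := mul_le_mul_of_nonneg_left (hb'.2.1 t t' i) hy
      simp only [ContinuousMap.add_apply, ContinuousMap.smul_apply, Pi.add_apply, Pi.smul_apply,
        smul_eq_mul]
      linarith
    · simp only [ContinuousMap.add_apply, ContinuousMap.smul_apply, Pi.add_apply, Pi.smul_apply,
        smul_eq_mul, Finset.sum_add_distrib, ← Finset.mul_sum]
      rw [hb.2.2, hb'.2.2, mul_one, mul_one, hxy]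
  have hKcomp : IsCompact {b : C(Icc 0 T, Fin n → ℝ) | ⇑b ∈ Z} := by
    refine isCompact_setOf_coe_mem (L := M / m) (ω := ω) ?_ ?_ ?_ fun v hv => hv.2
    · refine (isClosed_coneBase hT).inter ?_
      simp only [Set.ofPred_forall]
      have hc : ∀ (t : Icc 0 T) (i : Fin n), Continuous fun b : Icc 0 T → Fin n → ℝ => b t i :=
        fun t i => (continuous_apply i).comp (continuous_apply t)
      exact isClosed_iInter fun t => isClosed_iInter fun t' => isClosed_iInter fun i =>
        isClosed_le ((hc t i).sub (hc t' i)).abs continuous_const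
    · intro v hv t i
      have h1 : v t₀ i ≤ 1 := hv.1.2.2 ▸ Finset.single_le_sum (f := fun i => v t₀ i)
        (fun i _ => hv.1.1 t₀ i) (Finset.mem_univ i)
      rw [abs_of_nonneg (hv.1.1 t i), le_div_iff₀ hm]
      nlinarith [hv.1.2.1 t t₀ i]
    · intro t
      have hc : Continuous (ω t) := (continuous_finsetSum _ fun i _ =>
        (continuous_const.sub (kernelCurry hk T i).continuous).norm).div_const m
      simpa [hω] using hc.tendsto t
  have hshell : ∀ z ∈ Icc r R ×ˢ B, ∀ t, (z.1 • z.2) t ∈ shell n m M r R := fun z hz t =>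
    smul_mem_shell hT hz.2 hm hM hr hz.1 t
  have hsrc : ∀ z ∈ Icc r R ×ˢ B, ∀ i, ∀ s ∈ Icc 0 T,
      0 < H i s ((z.1 • z.2) (projIcc 0 T hT.le s)) := fun z hz i s hs =>
    hpos i s hs _ (hshell z hz _)
  have hIpos : ∀ z ∈ Icc r R ×ˢ B, ∀ i, 0 < I (z.1 • z.2) i := fun z hz i =>
    intervalIntegral.intervalIntegral_pos_of_pos_on
      ((continuous_source hH hT (z.1 • z.2) i).intervalIntegrable _ _)
      (fun s hs => hsrc z hz i s (Ioo_subset_Icc_self hs)) hT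
  have hlow : ∀ z ∈ Icc r R ×ˢ B, ∀ t i, m * I (z.1 • z.2) i ≤ A (z.1 • z.2) t i :=
    fun z hz t i => le_hammerstein hk hH hT hkm (fun i s hs => (hsrc z hz i s hs).le) t i
  have hupp : ∀ z ∈ Icc r R ×ˢ B, ∀ t i, A (z.1 • z.2) t i ≤ M * I (z.1 • z.2) i :=
    fun z hz t i => hammerstein_le hk hH hT hkM (fun i s hs => (hsrc z hz i s hs).le) t i
  have hAnn : ∀ z ∈ Icc r R ×ˢ B, ∀ t i, 0 < A (z.1 • z.2) t i := fun z hz t i =>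
    (mul_pos hm (hIpos z hz i)).trans_le (hlow z hz t i)
  have hθle : ∀ z ∈ Icc r R ×ˢ B, ∀ i, A (z.1 • z.2) t₀ i ≤ θ z := fun z hz i =>
    Finset.single_le_sum (f := fun i => A (z.1 • z.2) t₀ i) (fun i _ => (hAnn z hz t₀ i).le)
      (Finset.mem_univ i)
  have hθpos : ∀ z ∈ Icc r R ×ˢ B, 0 < θ z := fun z hz =>
    (hAnn z hz t₀ ⟨0, hn⟩).trans_le (hθle z hz _)
  have hAz : Continuous fun z : ℝ × C(Icc 0 T, Fin n → ℝ) => A (z.1 • z.2) :=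
    hAc.comp (continuous_fst.smul continuous_snd)
  have hθc : Continuous θ := continuous_finsetSum _ fun i _ =>
    (continuous_apply i).comp (hAz.eval_const t₀)
  obtain ⟨ρ, hρ, b, hb, hfix, hend⟩ := exists_radial_fixedPoint (B := B)
    (K := {b : C(Icc 0 T, Fin n → ℝ) | ⇑b ∈ Z}) hBconv hBne hKcomp (fun b hb => hb.1) hrR
    (P := fun z => (θ z)⁻¹ • A (z.1 • z.2)) (η := fun z => ε * (θ z - z.1))
    ((hθc.continuousOn.inv₀ fun z hz => (hθpos z hz).ne').smul hAz.continuousOn)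
    (by fun_prop) (by
      intro z hz
      have hinv : 0 < (θ z)⁻¹ := inv_pos.mpr (hθpos z hz)
      refine ⟨⟨fun t i => mul_nonneg hinv.le (hAnn z hz t i).le, fun t t' i => ?_, ?_⟩,
        fun t t' i => ?_⟩
      · have h1 : m * A (z.1 • z.2) t i ≤ M * A (z.1 • z.2) t' i := by
          nlinarith [hlow z hz t' i, hupp z hz t i]
        have h2 := mul_le_mul_of_nonneg_left h1 hinv.le
        simp only [ContinuousMap.smul_apply, Pi.smul_apply, smul_eq_mul]
        linarith
      · simp only [ContinuousMap.smul_apply, Pi.smul_apply, smul_eq_mul, ← Finset.mul_sum]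
        exact inv_mul_cancel₀ (hθpos z hz).ne'
      · have h1 := abs_hammerstein_sub_le hk hH hT (fun i s hs => (hsrc z hz i s hs).le) t t' i
        have h2 : m * I (z.1 • z.2) i ≤ θ z := (hlow z hz t₀ i).trans (hθle z hz i)
        have h3 : ‖kernelCurry hk T i t - kernelCurry hk T i t'‖ ≤
            ∑ j, ‖kernelCurry hk T j t - kernelCurry hk T j t'‖ :=
          Finset.single_le_sum (f := fun j => ‖kernelCurry hk T j t - kernelCurry hk T j t'‖)
            (fun _ _ => norm_nonneg _) (Finset.mem_univ i)
        simp only [ContinuousMap.smul_apply, Pi.smul_apply, smul_eq_mul]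
        rw [← mul_sub, abs_mul, abs_of_pos hinv, hω, inv_mul_le_iff₀ (hθpos z hz), ← mul_div_assoc,
          le_div_iff₀ hm]
        refine (mul_le_mul_of_nonneg_right h1 hm.le).trans ?_
        calc _ = ‖kernelCurry hk T i t - kernelCurry hk T i t'‖ * (m * I (z.1 • z.2) i) := by ring
          _ ≤ (∑ j, ‖kernelCurry hk T j t - kernelCurry hk T j t'‖) * θ z :=
              mul_le_mul h3 h2 (mul_pos hm (hIpos z hz i)).le
                (Finset.sum_nonneg fun _ _ => norm_nonneg _)
          _ = _ := mul_comm _ _)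
  have hz : (ρ, b) ∈ Icc r R ×ˢ B := ⟨hρ, hb⟩
  have hθρ : θ (ρ, b) = ρ := by
    rcases hend with h | ⟨rfl, h⟩ | ⟨rfl, h⟩
    · exact sub_eq_zero.mp ((mul_eq_zero.mp h).resolve_left hε)
    · exact absurd h (not_lt.mpr (hrε (ρ • b) fun t =>
        smul_mem_shell hT hb hm hM hr (left_mem_Icc.mpr le_rfl) t))
    · exact absurd h (not_lt.mpr (hRε (ρ • b) fun t =>
        smul_mem_shell hT hb hm hM (hr.trans_le hrR) (left_mem_Icc.mpr le_rfl) t))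
  have hAfix : A (ρ • b) = ρ • b := by
    have h1 := congrArg (fun v => θ (ρ, b) • v) hfix
    simp only [smul_inv_smul₀ (hθpos _ hz).ne'] at h1
    rw [h1, hθρ]
  refine ⟨ρ • b, hAfix, hshell _ hz, ?_⟩
  have hsum := hθρ
  simp only [hθ] at hsum
  rw [hAfix] at hsum
  rw [hsum]
  exact hρ

end Cone

end PeriodicSystem

/-! ### Existence of solutions from bounds on the right-hand side -/

namespace PeriodicSystem

/-- The standing assumptions on the system, with bounds `m` and `M` for the Green functions in
place of their positivity. -/
structure IsSingularSystem {n : ℕ} (T m M : ℝ) (a g e : Fin n → ℝ → ℝ)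
    (f : Fin n → (Fin n → ℝ) → ℝ) (G : Fin n → ℝ → ℝ → ℝ) : Prop where
  one_le : 1 ≤ n
  T_pos : 0 < T
  m_pos : 0 < m
  M_pos : 0 < M
  green : ∀ i, IsPeriodicGreen T (a i) (G i)
  le_green : ∀ i, ∀ t ∈ Icc 0 T, ∀ s ∈ Icc 0 T, m ≤ G i t s
  green_le : ∀ i, ∀ t ∈ Icc 0 T, ∀ s ∈ Icc 0 T, G i t s ≤ M
  f_cont : ∀ i, ContinuousOn (f i) (puncturedOrthant n)
  f_pos : ∀ i, ∀ x ∈ puncturedOrthant n, 0 < f i x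
  a_cont : ∀ i, Continuous (a i)
  a_per : ∀ i, Function.Periodic (a i) T
  g_cont : ∀ i, Continuous (g i)
  g_per : ∀ i, Function.Periodic (g i) T
  e_cont : ∀ i, Continuous (e i)
  e_per : ∀ i, Function.Periodic (e i) T
  g_pos : ∀ i, ∀ t ∈ Icc 0 T, 0 < g i t

section Bounds

variable {n : ℕ} {T m M : ℝ} {k : Fin n → ℝ → ℝ → ℝ} {H : Fin n → ℝ → (Fin n → ℝ) → ℝ}
  (hk : ∀ i, Continuous fun z : ℝ × ℝ => k i z.1 z.2)
  (hH : ∀ i, Continuous fun z : ℝ × (Fin n → ℝ) => H i z.1 z.2) (hT : 0 < T)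
  {u : C(Icc 0 T, Fin n → ℝ)}

lemma le_sum_hammerstein (hn : 1 ≤ n) (hm : 0 < m) (hkm : ∀ i t s, m ≤ k i t s)
    (hu : ∀ i, ∀ s ∈ Icc 0 T, 0 ≤ H i s (u (projIcc 0 T hT.le s))) {ρ : ℝ}
    (hρ : ∀ i, ∀ s ∈ Icc 0 T, ρ ≤ n * m * T * H i s (u (projIcc 0 T hT.le s))) (t : Icc 0 T) :
    ρ ≤ ∑ i, hammerstein hk hH hT u t i := by
  have hn0 : (0 : ℝ) < n := by exact_mod_cast hn
  have hle : ∀ i ∈ Finset.univ, ρ / n ≤ hammerstein hk hH hT u t i := by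
    intro i _
    refine le_trans ?_ (le_hammerstein hk hH hT hkm hu t i)
    have h1 : ∫ _s in (0 : ℝ)..T, ρ / (n * m * T)
        ≤ ∫ s in (0 : ℝ)..T, H i s (u (projIcc 0 T hT.le s)) :=
      intervalIntegral.integral_mono_on hT.le (continuous_const.intervalIntegrable _ _)
        ((continuous_source hH hT u i).intervalIntegrable _ _) fun s hs => by
          rw [div_le_iff₀ (by positivity), mul_comm]
          exact hρ i s hs
    rw [intervalIntegral.integral_const, sub_zero, smul_eq_mul] at h1
    calc ρ / n = m * (T * (ρ / (n * m * T))) := by field_simp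
      _ ≤ _ := mul_le_mul_of_nonneg_left h1 hm.le
  have := Finset.sum_le_sum hle
  rwa [Finset.sum_const, Finset.card_univ, Fintype.card_fin, nsmul_eq_mul,
    mul_div_cancel₀ _ hn0.ne'] at this

lemma sum_hammerstein_le (hn : 1 ≤ n) (hM : 0 < M) (hkM : ∀ i t s, k i t s ≤ M)
    (hu : ∀ i, ∀ s ∈ Icc 0 T, 0 ≤ H i s (u (projIcc 0 T hT.le s))) {ρ : ℝ}
    (hρ : ∀ i, ∀ s ∈ Icc 0 T, n * M * T * H i s (u (projIcc 0 T hT.le s)) ≤ ρ) (t : Icc 0 T) :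
    ∑ i, hammerstein hk hH hT u t i ≤ ρ := by
  have hn0 : (0 : ℝ) < n := by exact_mod_cast hn
  have hle : ∀ i ∈ Finset.univ, hammerstein hk hH hT u t i ≤ ρ / n := by
    intro i _
    refine le_trans (hammerstein_le hk hH hT hkM hu t i) ?_
    have h1 : ∫ s in (0 : ℝ)..T, H i s (u (projIcc 0 T hT.le s))
        ≤ ∫ _s in (0 : ℝ)..T, ρ / (n * M * T) :=
      intervalIntegral.integral_mono_on hT.le
        ((continuous_source hH hT u i).intervalIntegrable _ _)
        (continuous_const.intervalIntegrable _ _) fun s hs => by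
          rw [le_div_iff₀ (by positivity), mul_comm]
          exact hρ i s hs
    rw [intervalIntegral.integral_const, sub_zero, smul_eq_mul] at h1
    calc _ ≤ M * (T * (ρ / (n * M * T))) := mul_le_mul_of_nonneg_left h1 hM.le
      _ = ρ / n := by field_simp
  have := Finset.sum_le_sum hle
  rwa [Finset.sum_const, Finset.card_univ, Fintype.card_fin, nsmul_eq_mul,
    mul_div_cancel₀ _ hn0.ne'] at this

end Bounds

section Existence

variable {n : ℕ} {T m M : ℝ} {a g e : Fin n → ℝ → ℝ} {f : Fin n → (Fin n → ℝ) → ℝ}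
  {G : Fin n → ℝ → ℝ → ℝ}

lemma shell_subset_shell (hm : 0 < m) (hM : 0 < M) {r R ρ ρ' : ℝ} (hr : r ≤ ρ) (hR : ρ' ≤ R) :
    shell n m M ρ ρ' ⊆ shell n m M r R := fun _ hx =>
  ⟨hx.1, (mul_le_mul_of_nonneg_left hr hm.le).trans hx.2.1,
    hx.2.2.trans (mul_le_mul_of_nonneg_left hR hM.le)⟩

lemma exists_extension_of_shell (hm : 0 < m) (hM : 0 < M)
    (hf : ∀ i, ContinuousOn (f i) (puncturedOrthant n)) {r : ℝ} (hr : 0 < r) (R : ℝ) :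
    ∃ f' : Fin n → C(Fin n → ℝ, ℝ), ∀ i, ∀ x ∈ shell n m M r R, f' i x = f i x := by
  have h : ∀ i, ∃ F : C(Fin n → ℝ, ℝ), ∀ x ∈ shell n m M r R, F x = f i x := by
    intro i
    have hc := (hf i).mono (shell_subset_puncturedOrthant hm hM hr R)
    obtain ⟨F, hF⟩ := ContinuousMap.exists_restrict_eq (isCompact_shell hm r R).isClosed
      ⟨_, continuousOn_iff_continuous_domRestrict.mp hc⟩
    exact ⟨F, fun x hx => congrArg (fun q => q ⟨x, hx⟩) hF⟩
  choose f' hf' using h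
  exact ⟨f', hf'⟩

/-- Existence of a solution whose size at time `0` lies in `[r, R]`, from pointwise bounds on the
right-hand side: positivity on the whole shell, and one of the two opposite pairs of inequalities
(compression or expansion) at its ends. -/
theorem IsSingularSystem.exists_solution (hS : IsSingularSystem T m M a g e f G) {lam : ℝ}
    {r R : ℝ} (hr : 0 < r) (hrR : r ≤ R)
    (hpos : ∀ i, ∀ s ∈ Icc 0 T, ∀ x ∈ shell n m M r R, 0 < lam * g i s * f i x + lam * e i s)
    (hend :
      ((∀ i, ∀ s ∈ Icc 0 T, ∀ x ∈ shell n m M r r,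
          r ≤ n * m * T * (lam * g i s * f i x + lam * e i s)) ∧
        ∀ i, ∀ s ∈ Icc 0 T, ∀ x ∈ shell n m M R R,
          n * M * T * (lam * g i s * f i x + lam * e i s) ≤ R) ∨
      ((∀ i, ∀ s ∈ Icc 0 T, ∀ x ∈ shell n m M r r,
          n * M * T * (lam * g i s * f i x + lam * e i s) ≤ r) ∧
        ∀ i, ∀ s ∈ Icc 0 T, ∀ x ∈ shell n m M R R,
          R ≤ n * m * T * (lam * g i s * f i x + lam * e i s))) :
    ∃ x, IsPositivePeriodicSolution T a g e f lam x ∧ ∑ i, x 0 i ∈ Icc r R := by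
  have hT := hS.T_pos
  have hm := hS.m_pos
  have hM := hS.M_pos
  obtain ⟨f', hf'⟩ := exists_extension_of_shell hm hM hS.f_cont hr R
  set k : Fin n → ℝ → ℝ → ℝ := fun i => greenExt hT (G i) with hkdef
  set H : Fin n → ℝ → (Fin n → ℝ) → ℝ :=
    fun i s x => lam * g i s * f' i x + lam * e i s with hHdef
  have hk : ∀ i, Continuous fun z : ℝ × ℝ => k i z.1 z.2 := fun i =>
    (hS.green i).continuous_greenExt hT
  have hH : ∀ i, Continuous fun z : ℝ × (Fin n → ℝ) => H i z.1 z.2 := fun i =>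
    ((continuous_const.mul ((hS.g_cont i).comp continuous_fst)).mul
      ((f' i).continuous.comp continuous_snd)).add
      (continuous_const.mul ((hS.e_cont i).comp continuous_fst))
  have hHf : ∀ i s, ∀ x ∈ shell n m M r R, H i s x = lam * g i s * f i x + lam * e i s :=
    fun i s x hx => by simp only [hHdef, hf' i x hx]
  have hkm : ∀ i t s, m ≤ k i t s := fun i t s =>
    hS.le_green i _ (Subtype.coe_prop _) _ (Subtype.coe_prop _)
  have hkM : ∀ i t s, k i t s ≤ M := fun i t s =>
    hS.green_le i _ (Subtype.coe_prop _) _ (Subtype.coe_prop _)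
  have hHpos : ∀ i, ∀ s ∈ Icc 0 T, ∀ x ∈ shell n m M r R, 0 < H i s x := fun i s hs x hx =>
    hHf i s x hx ▸ hpos i s hs x hx
  have hsubr : shell n m M r r ⊆ shell n m M r R := shell_subset_shell hm hM le_rfl hrR
  have hsubR : shell n m M R R ⊆ shell n m M r R := shell_subset_shell hm hM hrR le_rfl
  have hnn : ∀ u : C(Icc 0 T, Fin n → ℝ), (∀ t, u t ∈ shell n m M r R) →
      ∀ i, ∀ s ∈ Icc 0 T, 0 ≤ H i s (u (projIcc 0 T hT.le s)) := fun u hu i s hs =>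
    (hHpos i s hs _ (hu _)).le
  obtain ⟨u, hAu, hush, husum⟩ : ∃ u : C(Icc 0 T, Fin n → ℝ), hammerstein hk hH hT u = u ∧
      (∀ t, u t ∈ shell n m M r R) ∧ ∑ i, u ⟨0, left_mem_Icc.mpr hT.le⟩ i ∈ Icc r R := by
    rcases hend with ⟨h1, h2⟩ | ⟨h1, h2⟩
    · refine exists_hammerstein_fixedPoint hk hH hT hS.one_le hm hM hkm hkM hr hrR hHpos
        one_ne_zero (fun u hu => ?_) (fun u hu => ?_)
      · have := le_sum_hammerstein hk hH hT hS.one_le hm hkm (hnn u fun t => hsubr (hu t))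
          (fun i s hs => by
            rw [hHf i s _ (hsubr (hu _))]; exact h1 i s hs _ (hu _)) ⟨0, left_mem_Icc.mpr hT.le⟩
        linarith
      · have := sum_hammerstein_le hk hH hT hS.one_le hM hkM (hnn u fun t => hsubR (hu t))
          (fun i s hs => by
            rw [hHf i s _ (hsubR (hu _))]; exact h2 i s hs _ (hu _)) ⟨0, left_mem_Icc.mpr hT.le⟩
        linarith
    · refine exists_hammerstein_fixedPoint hk hH hT hS.one_le hm hM hkm hkM hr hrR hHpos
        (neg_ne_zero.mpr one_ne_zero) (fun u hu => ?_) (fun u hu => ?_)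
      · have := sum_hammerstein_le hk hH hT hS.one_le hM hkM (hnn u fun t => hsubr (hu t))
          (fun i s hs => by
            rw [hHf i s _ (hsubr (hu _))]; exact h1 i s hs _ (hu _)) ⟨0, left_mem_Icc.mpr hT.le⟩
        linarith
      · have := le_sum_hammerstein hk hH hT hS.one_le hm hkm (hnn u fun t => hsubR (hu t))
          (fun i s hs => by
            rw [hHf i s _ (hsubR (hu _))]; exact h2 i s hs _ (hu _)) ⟨0, left_mem_Icc.mpr hT.le⟩
        linarith
  -- the fixed point is the potential of its source term, hence extends periodically
  set w : ℝ → Fin n → ℝ := fun t => u (projIcc 0 T hT.le t) with hw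
  have hwc : Continuous w := u.continuous.comp continuous_projIcc
  have hwpot : ∀ i, ∀ t ∈ Icc 0 T, w t i = potential hT (G i) (fun s => H i s (w s)) t := by
    intro i t ht
    have h1 : w t = u ⟨t, ht⟩ := by simp only [hw, projIcc_of_mem hT.le ht]
    rw [h1]
    conv_lhs => rw [← hAu]
    rfl
  have hsc : ∀ i, Continuous fun s => H i s (w s) := fun i =>
    (hH i).comp (continuous_id.prodMk hwc)
  have hw0T : w 0 = w T := funext fun i => by
    rw [hwpot i 0 (left_mem_Icc.mpr hT.le), hwpot i T (right_mem_Icc.mpr hT.le)]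
    exact ((hS.green i).potential_taylor hT (hS.a_cont i) (hsc i)).1
  obtain ⟨v, hvc, hvT, hvw⟩ := exists_periodic_extension hT hwc hw0T
  have hvsh : ∀ t, v t ∈ shell n m M r R := by
    intro t
    obtain ⟨s, hs, hst⟩ := hvT.exists_mem_Ico₀ hT t
    rw [hst, hvw s (Ico_subset_Icc_self hs)]
    exact hush _
  have hy : ∀ i, ∃ y : ℝ → ℝ, ContDiff ℝ 2 y ∧ (∀ t, y t = v t i) ∧
      ∀ t, deriv (deriv y) t + a i t * y t = H i t (v t) := by
    intro i
    obtain ⟨y, hy2, hyT, hypot, hyeq⟩ := (hS.green i).exists_periodic_solution hT (hS.a_cont i)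
      (hS.a_per i) (h := fun s => H i s (v s)) ((hH i).comp (continuous_id.prodMk hvc))
      (fun t => by simp only [hHdef, hS.g_per i t, hS.e_per i t, hvT t])
    refine ⟨y, hy2, ?_, hyeq⟩
    refine eq_of_periodic_of_eqOn hT hyT (fun t => by rw [hvT t]) fun t ht => ?_
    rw [hypot t ht, hvw t ht, hwpot i t ht]
    refine integral_congr_Ioo hT fun s hs => ?_
    simp only [hvw s (Ioo_subset_Icc_self hs)]
  choose y hy2 hyv hyeq using hy
  have hyv' : ∀ i, (fun t => v t i) = y i := fun i => funext fun t => (hyv i t).symm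
  refine ⟨v, ⟨?_, hvT, fun t i => ?_, fun t i => ?_⟩, ?_⟩
  · exact contDiff_pi.mpr fun i => hyv' i ▸ hy2 i
  · obtain ⟨s, hs, hst⟩ := hvT.exists_mem_Ico₀ hT t
    have hs' := Ico_subset_Icc_self hs
    rw [hst, hvw s hs']
    simp only [hw]
    rw [← hAu]
    refine lt_of_lt_of_le ?_ (le_hammerstein hk hH hT hkm (hnn u hush) _ i)
    exact mul_pos hm (intervalIntegral.intervalIntegral_pos_of_pos_on
      ((hsc i).intervalIntegrable _ _)
      (fun s hs => hHpos i s (Ioo_subset_Icc_self hs) _ (hush _)) hT)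
  · rw [hyv' i, ← hyv i t, hyeq i t, hHf i t _ (hvsh t)]
  · have h0 : v 0 = u ⟨0, left_mem_Icc.mpr hT.le⟩ := by
      rw [hvw 0 (left_mem_Icc.mpr hT.le)]
      simp only [hw, projIcc_left]
    rw [h0]
    exact husum

end Existence

/-! ### Bounds for the right-hand side and choice of the shells -/

section Bounds

variable {n : ℕ} {T m M : ℝ} {a g e : Fin n → ℝ → ℝ} {f : Fin n → (Fin n → ℝ) → ℝ}
  {G : Fin n → ℝ → ℝ → ℝ}

lemma exists_forall_le_of_isCompact {ι X : Type*} [Finite ι] [TopologicalSpace X] {K : Set X}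
    (hK : IsCompact K) {φ : ι → X → ℝ} (hφ : ∀ i, ContinuousOn (φ i) K) :
    ∃ U > 0, ∀ i, ∀ x ∈ K, φ i x ≤ U := by
  have h : ∀ i, ∀ᶠ U in atTop, ∀ x ∈ K, φ i x ≤ U := by
    intro i
    obtain ⟨c, hc⟩ := (hK.image_of_continuousOn (hφ i)).bddAbove
    filter_upwards [eventually_ge_atTop c] with U hU x hx
    exact (hc (mem_image_of_mem _ hx)).trans hU
  exact ((eventually_gt_atTop 0).and (eventually_all.mpr h)).exists

lemma exists_forall_ge_of_isCompact {ι X : Type*} [Finite ι] [TopologicalSpace X] {K : Set X}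
    (hK : IsCompact K) {φ : ι → X → ℝ} (hφ : ∀ i, ContinuousOn (φ i) K)
    (hpos : ∀ i, ∀ x ∈ K, 0 < φ i x) : ∃ c > 0, ∀ i, ∀ x ∈ K, c ≤ φ i x := by
  obtain ⟨U, hU, h⟩ := exists_forall_le_of_isCompact hK (φ := fun i x => (φ i x)⁻¹)
    fun i => (hφ i).inv₀ fun x hx => (hpos i x hx).ne'
  exact ⟨U⁻¹, inv_pos.mpr hU, fun i x hx => inv_le_of_inv_le₀ (hpos i x hx) (h i x hx)⟩

lemma exists_forall_of_eventually_nearZero {P : (Fin n → ℝ) → Prop}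
    (h : ∀ᶠ x in nearZero n, P x) :
    ∃ δ > 0, ∀ x ∈ puncturedOrthant n, sumNorm x ≤ δ → P x := by
  obtain ⟨δ, hδ, hP⟩ := Metric.mem_nhdsWithin_iff.mp h
  refine ⟨δ / 2, half_pos hδ, fun x hx hxδ => hP ⟨?_, hx⟩⟩
  rw [Metric.mem_ball, dist_zero_right]
  refine lt_of_le_of_lt ?_ (half_lt_self hδ)
  exact (pi_norm_le_iff_of_nonneg (half_pos hδ).le).mpr fun i =>
    (abs_apply_le_sumNorm x i).trans hxδ

lemma exists_forall_of_eventually_nearInfty {P : (Fin n → ℝ) → Prop}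
    (h : ∀ᶠ x in nearInfty n, P x) :
    ∃ Δ > 0, ∀ x ∈ puncturedOrthant n, Δ ≤ sumNorm x → P x := by
  rw [nearInfty, eventually_inf_principal, eventually_comap] at h
  obtain ⟨Δ, hΔ⟩ := eventually_atTop.mp h
  exact ⟨max 1 Δ, lt_max_of_lt_left one_pos, fun x hx hxΔ =>
    hΔ _ ((le_max_right _ _).trans hxΔ) x rfl hx⟩

namespace IsSingularSystem

lemma exists_coefficient_bounds (hS : IsSingularSystem T m M a g e f G) :
    ∃ γ > 0, ∃ Γ > 0, ∃ E > 0, ∀ i, ∀ s ∈ Icc 0 T, γ ≤ g i s ∧ g i s ≤ Γ ∧ |e i s| ≤ E := by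
  obtain ⟨γ, hγ, h1⟩ := exists_forall_ge_of_isCompact isCompact_Icc
    (fun i => (hS.g_cont i).continuousOn) hS.g_pos
  obtain ⟨Γ, hΓ, h2⟩ := exists_forall_le_of_isCompact (isCompact_Icc (a := 0) (b := T))
    (fun i => (hS.g_cont i).continuousOn)
  obtain ⟨E, hE, h3⟩ := exists_forall_le_of_isCompact (isCompact_Icc (a := 0) (b := T))
    (φ := fun i s => |e i s|) (fun i => (hS.e_cont i).abs.continuousOn)
  exact ⟨γ, hγ, Γ, hΓ, E, hE, fun i s hs => ⟨h1 i s hs, h2 i s hs, h3 i s hs⟩⟩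

/-- The right-hand side is at least `1` wherever all `f i` are large. -/
lemma one_le_source (hS : IsSingularSystem T m M a g e f G) :
    ∃ L : ℝ, ∀ x, (∀ i, L ≤ f i x) → ∀ i, ∀ s ∈ Icc 0 T, 1 ≤ g i s * f i x + e i s := by
  obtain ⟨γ, hγ, Γ, -, E, hE, hb⟩ := hS.exists_coefficient_bounds
  refine ⟨(1 + E) / γ, fun x hx i s hs => ?_⟩
  obtain ⟨h1, -, h3⟩ := hb i s hs
  have h4 : γ * ((1 + E) / γ) ≤ g i s * f i x :=
    mul_le_mul h1 (hx i) (by positivity) (hγ.le.trans h1)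
  rw [mul_div_cancel₀ _ hγ.ne'] at h4
  linarith [(abs_le.mp h3).1]

lemma exists_source_le (hS : IsSingularSystem T m M a g e f G) {r : ℝ} (hr : 0 < r) (R : ℝ) :
    ∃ U > 0, ∀ i, ∀ s ∈ Icc 0 T, ∀ x ∈ shell n m M r R, g i s * f i x + e i s ≤ U := by
  obtain ⟨γ, -, Γ, hΓ, E, hE, hb⟩ := hS.exists_coefficient_bounds
  have hsub := shell_subset_puncturedOrthant (n := n) hS.m_pos hS.M_pos hr R
  obtain ⟨U, hU, hfU⟩ := exists_forall_le_of_isCompact (isCompact_shell (M := M) hS.m_pos r R)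
    fun i => (hS.f_cont i).mono hsub
  refine ⟨Γ * U + E, by positivity, fun i s hs x hx => ?_⟩
  obtain ⟨-, h2, h3⟩ := hb i s hs
  have h4 : g i s * f i x ≤ Γ * U :=
    mul_le_mul h2 (hfU i x hx) (hS.f_pos i x (hsub hx)).le hΓ.le
  linarith [(abs_le.mp h3).2]

lemma exists_source_le_of_sublinear (hS : IsSingularSystem T m M a g e f G)
    (hf : ∀ i, Tendsto (fun x => f i x / sumNorm x) (nearInfty n) (𝓝 0)) {c : ℝ} (hc : 0 < c) :
    ∃ Δ > 0, ∀ x ∈ puncturedOrthant n, Δ ≤ sumNorm x → ∀ i, ∀ s ∈ Icc 0 T,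
      g i s * f i x + e i s ≤ c * sumNorm x := by
  obtain ⟨γ, -, Γ, hΓ, E, hE, hb⟩ := hS.exists_coefficient_bounds
  obtain ⟨Δ, hΔ, h⟩ := exists_forall_of_eventually_nearInfty (eventually_all.mpr fun i =>
    (hf i).eventually (gt_mem_nhds (show 0 < c / (2 * Γ) by positivity)))
  refine ⟨max Δ (2 * E / c), lt_max_of_lt_left hΔ, fun x hx hxΔ i s hs => ?_⟩
  obtain ⟨-, h2, h3⟩ := hb i s hs
  have h4 := h x hx ((le_max_left _ _).trans hxΔ) i
  rw [div_lt_iff₀ hx.2] at h4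
  have h5 : g i s * f i x ≤ Γ * (c / (2 * Γ) * sumNorm x) :=
    mul_le_mul h2 h4.le (hS.f_pos i x hx).le hΓ.le
  have h6 : Γ * (c / (2 * Γ) * sumNorm x) = c * sumNorm x / 2 := by field_simp
  have h7 := (le_max_right _ _).trans hxΔ
  rw [div_le_iff₀ hc] at h7
  linarith [(abs_le.mp h3).2]

lemma exists_le_source_of_superlinear (hS : IsSingularSystem T m M a g e f G)
    (hf : ∀ i, Tendsto (fun x => f i x / sumNorm x) (nearInfty n) atTop) {c : ℝ} (hc : 0 < c) :
    ∃ Δ > 0, ∀ x ∈ puncturedOrthant n, Δ ≤ sumNorm x → ∀ i, ∀ s ∈ Icc 0 T,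
      c * sumNorm x ≤ g i s * f i x + e i s := by
  obtain ⟨γ, hγ, Γ, -, E, hE, hb⟩ := hS.exists_coefficient_bounds
  obtain ⟨Δ, hΔ, h⟩ := exists_forall_of_eventually_nearInfty (eventually_all.mpr fun i =>
    (hf i).eventually (eventually_ge_atTop ((c + E) / γ)))
  refine ⟨max Δ 1, lt_max_of_lt_left hΔ, fun x hx hxΔ i s hs => ?_⟩
  obtain ⟨h1, -, h3⟩ := hb i s hs
  have h4 := h x hx ((le_max_left _ _).trans hxΔ) i
  rw [le_div_iff₀ hx.2] at h4
  have h5 : γ * ((c + E) / γ * sumNorm x) ≤ g i s * f i x :=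
    mul_le_mul h1 h4 (mul_nonneg (by positivity) hx.2.le) (hγ.le.trans h1)
  have h6 : γ * ((c + E) / γ * sumNorm x) = (c + E) * sumNorm x := by field_simp
  have h7 := (le_max_right _ _).trans hxΔ
  nlinarith [(abs_le.mp h3).1]

/-- For small parameters there is a solution of bounded size: near the origin the right-hand side
is bounded below, so the operator expands tiny functions, and it shrinks functions of a fixed
size when the parameter is small. -/
lemma exists_small_solution (hS : IsSingularSystem T m M a g e f G)
    (hf : ∀ i, Tendsto (f i) (nearZero n) atTop) :
    ∃ R > 0, ∃ lam₁ > 0, ∀ lam, 0 < lam → lam < lam₁ →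
      ∃ x, IsPositivePeriodicSolution T a g e f lam x ∧ ∑ i, x 0 i ≤ R := by
  have hT := hS.T_pos
  have hm := hS.m_pos
  have hM := hS.M_pos
  have hn : (0 : ℝ) < n := by exact_mod_cast hS.one_le
  obtain ⟨L, hL⟩ := hS.one_le_source
  obtain ⟨δ, hδ, hfδ⟩ := exists_forall_of_eventually_nearZero (eventually_all.mpr fun i =>
    (hf i).eventually (eventually_ge_atTop L))
  set R := m * δ / M with hR
  have hR0 : 0 < R := by positivity
  obtain ⟨U, hU, hSU⟩ := hS.exists_source_le hR0 R
  refine ⟨R, hR0, R / (n * M * T * U), by positivity, fun lam hlam hlam1 => ?_⟩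
  rw [lt_div_iff₀ (by positivity)] at hlam1
  -- a source that is at least `1` produces an image of size at least `n m T lam`
  set r := min R (n * m * T * lam) with hr
  have hr0 : 0 < r := lt_min hR0 (by positivity)
  have hrR : r ≤ R := min_le_left _ _
  have hone : ∀ i, ∀ s ∈ Icc 0 T, ∀ x ∈ shell n m M r R, 1 ≤ g i s * f i x + e i s := by
    intro i s hs x hx
    refine hL x (hfδ x (shell_subset_puncturedOrthant hm hM hr0 R hx) ?_) i s hs
    have h1 := hx.2.2
    rw [hR, mul_div_cancel₀ _ hM.ne'] at h1
    exact le_of_mul_le_mul_left h1 hm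
  suffices h : ∃ x, IsPositivePeriodicSolution T a g e f lam x ∧ ∑ i, x 0 i ∈ Icc r R from
    let ⟨x, hx, hxR⟩ := h
    ⟨x, hx, hxR.2⟩
  refine hS.exists_solution hr0 hrR (fun i s hs x hx => by nlinarith [hone i s hs x hx])
    (Or.inl ⟨fun i s hs x hx => ?_, fun i s hs x hx => ?_⟩)
  · have h1 := hone i s hs x (shell_subset_shell hm hM le_rfl hrR hx)
    have h2 := mul_le_mul_of_nonneg_left h1 (show 0 ≤ n * m * T * lam by positivity)
    have h3 : r ≤ n * m * T * lam := min_le_right _ _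
    linarith
  · have h2 := mul_le_mul_of_nonneg_left (hSU i s hs x hx) (show 0 ≤ n * M * T * lam by positivity)
    linarith

/-- In the superlinear case there is, for small parameters, a solution of size larger than any
prescribed bound: the operator shrinks functions of a fixed large size and expands very large
ones. -/
lemma exists_large_solution (hS : IsSingularSystem T m M a g e f G)
    (hf : ∀ i, Tendsto (fun x => f i x / sumNorm x) (nearInfty n) atTop) (R₀ : ℝ) :
    ∃ lam₁ > 0, ∀ lam, 0 < lam → lam < lam₁ →
      ∃ x, IsPositivePeriodicSolution T a g e f lam x ∧ R₀ < ∑ i, x 0 i := by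
  have hT := hS.T_pos
  have hm := hS.m_pos
  have hM := hS.M_pos
  have hn : (0 : ℝ) < n := by exact_mod_cast hS.one_le
  obtain ⟨Δ, hΔ, hfΔ⟩ := hS.exists_le_source_of_superlinear hf one_pos
  set r := max (R₀ + 1) (M * Δ / m) with hr
  have hr0 : 0 < r := lt_max_of_lt_right (by positivity)
  obtain ⟨U, hU, hSU⟩ := hS.exists_source_le hr0 r
  refine ⟨r / (n * M * T * U), by positivity, fun lam hlam hlam1 => ?_⟩
  rw [lt_div_iff₀ (by positivity)] at hlam1
  obtain ⟨Δ', hΔ', hfΔ'⟩ := hS.exists_le_source_of_superlinear hf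
    (show 0 < M / (n * m * T * lam * m) by positivity)
  set R := max r (M * Δ' / m) with hR
  have hrR : r ≤ R := le_max_left _ _
  have hsize : ∀ {D ρ ρ' : ℝ} {x : Fin n → ℝ}, M * D / m ≤ ρ → x ∈ shell n m M ρ ρ' →
      D ≤ sumNorm x := by
    intro D ρ ρ' x hρ hx
    rw [div_le_iff₀ hm] at hρ
    exact le_of_mul_le_mul_left (by linarith [hx.2.1]) hM
  suffices h : ∃ x, IsPositivePeriodicSolution T a g e f lam x ∧ ∑ i, x 0 i ∈ Icc r R from
    let ⟨x, hx, hxr⟩ := h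
    ⟨x, hx, by linarith [hxr.1, le_max_left (R₀ + 1) (M * Δ / m)]⟩
  refine hS.exists_solution hr0 hrR
    (fun i s hs x hx => ?_) (Or.inr ⟨fun i s hs x hx => ?_, fun i s hs x hx => ?_⟩)
  · have hxo := shell_subset_puncturedOrthant hm hM hr0 R hx
    have h1 := hfΔ x hxo (hsize (le_max_right _ _) hx) i s hs
    rw [mul_assoc, ← mul_add]
    exact mul_pos hlam (by linarith [hxo.2])
  · have h2 := mul_le_mul_of_nonneg_left (hSU i s hs x hx) (show 0 ≤ n * M * T * lam by positivity)
    linarith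
  · have hxo := shell_subset_puncturedOrthant hm hM (hr0.trans_le hrR) R hx
    have h1 := hfΔ' x hxo (hsize (le_max_right _ _) hx) i s hs
    have h2 := mul_le_mul_of_nonneg_left h1 (show 0 ≤ n * m * T * lam by positivity)
    have h3 : n * m * T * lam * (M / (n * m * T * lam * m) * sumNorm x) = M * sumNorm x / m := by
      field_simp
    have h4 : R ≤ M * sumNorm x / m := by
      rw [le_div_iff₀ hm]
      linarith [hx.2.1]
    linarith

/-- In the sublinear case there is a solution for large parameters: the operator expands
functions of a fixed large size and shrinks very large ones. -/
lemma exists_solution_of_sublinear (hS : IsSingularSystem T m M a g e f G)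
    (hf : ∀ i, Tendsto (f i) (nearInfty n) atTop)
    (hf' : ∀ i, Tendsto (fun x => f i x / sumNorm x) (nearInfty n) (𝓝 0)) :
    ∃ lam₀ > 0, ∀ lam, lam₀ < lam → ∃ x, IsPositivePeriodicSolution T a g e f lam x := by
  have hT := hS.T_pos
  have hm := hS.m_pos
  have hM := hS.M_pos
  have hn : (0 : ℝ) < n := by exact_mod_cast hS.one_le
  obtain ⟨L, hL⟩ := hS.one_le_source
  obtain ⟨Δ, hΔ, hfΔ⟩ := exists_forall_of_eventually_nearInfty (eventually_all.mpr fun i =>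
    (hf i).eventually (eventually_ge_atTop L))
  set r := M * Δ / m with hr
  have hr0 : 0 < r := by positivity
  have hlam00 : 0 < r / (n * m * T) := by positivity
  refine ⟨r / (n * m * T), hlam00, fun lam hlam0 => ?_⟩
  have hlam : 0 < lam := hlam00.trans hlam0
  rw [div_lt_iff₀ (by positivity)] at hlam0
  obtain ⟨Δ', hΔ', hfΔ'⟩ := hS.exists_source_le_of_sublinear hf'
    (show 0 < m / (n * M * T * lam * M) by positivity)
  set R := max r (M * Δ' / m) with hR
  have hrR : r ≤ R := le_max_left _ _
  have hsize : ∀ {D ρ ρ' : ℝ} {x : Fin n → ℝ}, M * D / m ≤ ρ → x ∈ shell n m M ρ ρ' →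
      D ≤ sumNorm x := by
    intro D ρ ρ' x hρ hx
    rw [div_le_iff₀ hm] at hρ
    exact le_of_mul_le_mul_left (by linarith [hx.2.1]) hM
  have hone : ∀ i, ∀ s ∈ Icc 0 T, ∀ x ∈ shell n m M r R, 1 ≤ g i s * f i x + e i s :=
    fun i s hs x hx => hL x (hfΔ x (shell_subset_puncturedOrthant hm hM hr0 R hx)
      (hsize le_rfl hx)) i s hs
  suffices h : ∃ x, IsPositivePeriodicSolution T a g e f lam x ∧ ∑ i, x 0 i ∈ Icc r R from
    let ⟨x, hx, _⟩ := h
    ⟨x, hx⟩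
  refine hS.exists_solution hr0 hrR (fun i s hs x hx => by nlinarith [hone i s hs x hx])
    (Or.inl ⟨fun i s hs x hx => ?_, fun i s hs x hx => ?_⟩)
  · have h1 := hone i s hs x (shell_subset_shell hm hM le_rfl hrR hx)
    have h2 := mul_le_mul_of_nonneg_left h1 (show 0 ≤ n * m * T * lam by positivity)
    linarith
  · have hxo := shell_subset_puncturedOrthant hm hM (hr0.trans_le hrR) R hx
    have h1 := hfΔ' x hxo (hsize (le_max_right _ _) hx) i s hs
    have h2 := mul_le_mul_of_nonneg_left h1 (show 0 ≤ n * M * T * lam by positivity)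
    have h3 : n * M * T * lam * (m / (n * M * T * lam * M) * sumNorm x) = m * sumNorm x / M := by
      field_simp
    have h4 : m * sumNorm x / M ≤ R := by
      rw [div_le_iff₀ hM]
      linarith [hx.2.2]
    linarith

end IsSingularSystem

end Bounds

end PeriodicSystem

theorem theorem2p2 (n : ℕ) (hn : 1 ≤ n) (T : ℝ) (hT : 0 < T)
    (a g e : Fin n → ℝ → ℝ) (f : Fin n → (Fin n → ℝ) → ℝ) (G : Fin n → ℝ → ℝ → ℝ)
    -- positivity of the Green functions
    (hG : ∀ i, PeriodicSystem.IsPeriodicGreen T (a i) (G i))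
    (hGpos : ∀ i, ∀ t ∈ Set.Icc 0 T, ∀ s ∈ Set.Icc 0 T, 0 < G i t s)
    -- the nonlinearities are continuous and positive away from the origin
    (hfcont : ∀ i, ContinuousOn (f i) (PeriodicSystem.puncturedOrthant n))
    (hfpos : ∀ i, ∀ x ∈ PeriodicSystem.puncturedOrthant n, 0 < f i x)
    -- the coefficients are continuous and periodic
    (hacont : ∀ i, Continuous (a i)) (haper : ∀ i, Function.Periodic (a i) T)
    (hgcont : ∀ i, Continuous (g i)) (hgper : ∀ i, Function.Periodic (g i) T)
    (hecont : ∀ i, Continuous (e i)) (heper : ∀ i, Function.Periodic (e i) T)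
    (hanonneg : ∀ i, ∀ t ∈ Set.Icc 0 T, 0 ≤ a i t)
    (hgpos : ∀ i, ∀ t ∈ Set.Icc 0 T, 0 < g i t)
    -- the nonlinearities are singular at the origin
    (hfzero : ∀ i, Filter.Tendsto (f i) (PeriodicSystem.nearZero n) Filter.atTop) :
    ((∀ i, Filter.Tendsto (f i) (PeriodicSystem.nearInfty n) Filter.atTop) →
      (∀ i, Filter.Tendsto (fun x => f i x / PeriodicSystem.sumNorm x)
        (PeriodicSystem.nearInfty n) (nhds 0)) →
      ∃ lam₀ : ℝ, 0 < lam₀ ∧ ∀ lam : ℝ, lam₀ < lam →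
        ∃ x, PeriodicSystem.IsPositivePeriodicSolution T a g e f lam x) ∧
    ((∀ i, Filter.Tendsto (fun x => f i x / PeriodicSystem.sumNorm x)
        (PeriodicSystem.nearInfty n) Filter.atTop) →
      ∃ lam₀ : ℝ, 0 < lam₀ ∧ ∀ lam : ℝ, 0 < lam → lam < lam₀ →
        ∃ x y, x ≠ y ∧ PeriodicSystem.IsPositivePeriodicSolution T a g e f lam x ∧
          PeriodicSystem.IsPositivePeriodicSolution T a g e f lam y) ∧
    (∃ lam₁ : ℝ, 0 < lam₁ ∧ ∀ lam : ℝ, 0 < lam → lam < lam₁ →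
      ∃ x, PeriodicSystem.IsPositivePeriodicSolution T a g e f lam x) := by
  obtain ⟨m, hm, hGm⟩ := PeriodicSystem.exists_forall_ge_of_isCompact
    ((isCompact_Icc (a := (0 : ℝ)) (b := T)).prod (isCompact_Icc (a := (0 : ℝ)) (b := T)))
    (φ := fun i z => G i z.1 z.2) (fun i => (hG i).continuousOn)
    (fun i z hz => hGpos i _ hz.1 _ hz.2)
  obtain ⟨M, hM, hGM⟩ := PeriodicSystem.exists_forall_le_of_isCompact
    ((isCompact_Icc (a := (0 : ℝ)) (b := T)).prod (isCompact_Icc (a := (0 : ℝ)) (b := T)))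
    (φ := fun i z => G i z.1 z.2) (fun i => (hG i).continuousOn)
  have hS : PeriodicSystem.IsSingularSystem T m M a g e f G :=
    ⟨hn, hT, hm, hM, hG, fun i t ht s hs => hGm i (t, s) ⟨ht, hs⟩,
      fun i t ht s hs => hGM i (t, s) ⟨ht, hs⟩, hfcont, hfpos, hacont, haper, hgcont, hgper,
      hecont, heper, hgpos⟩
  obtain ⟨R, -, lam₁, hlam₁, hsmall⟩ := hS.exists_small_solution hfzero
  refine ⟨fun hf hf' => ?_, fun hf => ?_, lam₁, hlam₁, fun lam h0 h1 => ?_⟩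
  · obtain ⟨lam₀, h0, h⟩ := hS.exists_solution_of_sublinear hf hf'
    exact ⟨lam₀, h0, h⟩
  · obtain ⟨lam₂, hlam₂, hlarge⟩ := hS.exists_large_solution hf R
    refine ⟨min lam₁ lam₂, lt_min hlam₁ hlam₂, fun lam h0 h1 => ?_⟩
    obtain ⟨x, hx, hxR⟩ := hsmall lam h0 (h1.trans_le (min_le_left _ _))
    -- the sizes at time `0` of the two solutions are separated by `R`
    obtain ⟨y, hy, hyR⟩ := hlarge lam h0 (h1.trans_le (min_le_right _ _))
    refine ⟨x, y, ?_, hx, hy⟩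
    rintro rfl
    exact absurd hyR (not_lt.mpr hxR)
  · obtain ⟨x, hx, -⟩ := hsmall lam h0 h1
    exact ⟨x, hx⟩
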